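/- Let $(\mathcal A,\varphi)$ be a noncommutative probability space: a unital associative algebra $\mathcal A$ over $\mathbb C$ with a linear functional $\varphi:\mathcal A\to\mathbb C$ such that $\varphi(1_{\mathcal A})=1$. For $n\ge 1$ put $\varphi_n(a_1,\dots,a_n)=\varphi(a_1\cdots a_n)$. Let $\operatorname{NC}(n)$ be the set of noncrossing partitions of $\{1,\dots,n\}$, i.e. of set partitions for which there are no $a<b<c<d$ with $a,c$ in one block and $b,d$ in a different block. For a family of multilinear functionals $f_m:\mathcal A^m\to\mathbb C$ ($m\ge1$) and $\pi\in\operatorname{NC}(n)$ write $$f_\pi(a_1,\dots,a_n)=\prod_{V\in\pi}f_{|V|}(a_{i_1},\dots,a_{i_s}),\qquad V=\{i_1<\dots<i_s\}.$$ Order the blocks of $\pi$ by nesting: $V\le W$ if every element of $W$ lies in $[\min V,\max V]$. The forest of nestings $t(\pi)$ is the rooted forest whose vertices are the blocks of $\pi$, with an edge from $V$ to $W$ whenever $W$ covers $V$ in this order, the roots being the minimal blocks. The factorial of a rooted tree is defined recursively by $t!=|t|\,s_1!\cdots s_m!$ if $t$ is obtained by grafting the trees $s_1,\dots,s_m$ to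 a root ($|t|$ is the number of vertices, and $t!=1$ for a single vertex), and the factorial of a forest is the product of the factorials of its trees. The monotone cumulants of $(\mathcal A,\varphi)$ are the multilinear functionals $h_n:\mathcal A^n\to\mathbb C$, $n\ge1$, recursively defined by $$\varphi_n(a_1,\dots,a_n)=\sum_{\pi\in\operatorname{NC}(n)}\frac1{t(\pi)!}\,h_\pi(a_1,\dots,a_n)\qquad(n\ge1,\ a_1,\dots,a_n\in\mathcal A).$$ A Schröder tree is a planar rooted tree in which every internal (non-leaf) vertex has at least two children; $\operatorname{ST}(n)$ is the finite set of Schröder trees with $n+1$ leaves. For $t\in\operatorname{ST}(n)$ with $n\ge1$: - The skeleton $\operatorname{sk}(t)$ is the planar rooted tree whose vertices are the internal vertices of $t$, with an edge from $v$ to $w$ if and only if $w$ is a child of $v$ in $t$. - Number the $n$ sectors between consecutive leaves of $t$ by $1,\dots,n$ from left to right. Each sector lies between two consecutive subtrees grafted to a unique internal vertex $v$. The noncrossing partition $\pi(t)\in\operatorname{NC}(n)$ has one block for each internal vertex $v$, consisting of the sectors that lie between consecutive subtrees grafted to $v$. The Murua coefficient of a planar rooted tree $s$ with $|s|$ vertices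 is $$\omega(s)=\sum_{k=1}^{|s|}\frac{(-1)^{k+1}}{k}\,\omega_k(s),$$ where $\omega_k(s)$ is the number of surjective maps $f$ from the vertices of $s$ onto $\{1,\dots,k\}$ such that $f(v)<f(w)$ whenever $w\ne v$ is a descendant of $v$. **Theorem.** For any noncommutative probability space $(\mathcal A,\varphi)$, any $n\ge1$ and any $a_1,\dots,a_n\in\mathcal A$, $$h_n(a_1,\dots,a_n)=\sum_{t\in\operatorname{ST}(n)}\omega(\operatorname{sk}(t))\,\varphi_{\pi(t)}(a_1,\dots,a_n).$$ -/

import Mathlib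

open Finset
open scoped BigOperators

/-! ### Planar rooted trees -/

/-- A planar rooted tree: a root together with the ordered list of the subtrees grafted to it. -/
inductive PlanarTree : Type
  | node : List PlanarTree → PlanarTree

namespace PlanarTree

/-- Whether the tree is reduced to a single vertex (its root is then a leaf). -/
def isLeaf : PlanarTree → Bool
  | node [] => true
  | node (_ :: _) => false

mutual
/-- The number of leaves (vertices without children). -/
def numLeaves : PlanarTree → ℕ
  | node [] => 1
  | node (t :: ts) => numLeaves t + numLeavesList ts
/-- The total number of leaves of a list of trees. -/
def numLeavesList : List PlanarTree → ℕ
  | [] => 0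
  | t :: ts => numLeaves t + numLeavesList ts
end

mutual
/-- The list of all vertices of a tree. A vertex is encoded by its address, i.e. the path from the
root to it: `[]` is the root, and `i :: p` is the vertex `p` of the `i`-th subtree grafted to the
root (counted from `0`). -/
def vertices : PlanarTree → List (List ℕ)
  | node ts => [] :: verticesFrom 0 ts
/-- The vertices lying in the trees of a list, the numbering of these trees starting at `i`. -/
def verticesFrom : ℕ → List PlanarTree → List (List ℕ)
  | _, [] => []
  | i, t :: ts => (vertices t).map (fun p => i :: p) ++ verticesFrom (i + 1) ts
end

/-- The vertex set of a planar rooted tree, to be seen as a poset. -/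
def Vertex (t : PlanarTree) : Type := {p : List ℕ // p ∈ t.vertices}

instance (t : PlanarTree) : DecidableEq t.Vertex :=
  inferInstanceAs (DecidableEq {p : List ℕ // p ∈ t.vertices})

instance (t : PlanarTree) : Fintype t.Vertex :=
  Fintype.subtype t.vertices.toFinset (fun _ => List.mem_toFinset)

/-- `v ≤ w` if and only if there is a downward path from `v` to `w`, that is, the address of `v` is
an initial segment of the address of `w`. The root is the smallest element. -/
instance (t : PlanarTree) : PartialOrder t.Vertex where
  le v w := v.1 <+: w.1
  le_refl v := List.prefix_refl v.1
  le_trans _ _ _ h₁ h₂ := h₁.trans h₂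
  le_antisymm _ _ h₁ h₂ := Subtype.ext (h₁.eq_of_length (le_antisymm h₁.length_le h₂.length_le))

/-! ### Murua coefficients -/

open Classical in
/-- The number of surjective maps `f` from the vertices of `t` onto a `k`-element chain such that
`v < w` implies `f v < f w`. -/
noncomputable def muruaCount (t : PlanarTree) (k : ℕ) : ℕ :=
  Fintype.card {f : t.Vertex → Fin k // Function.Surjective f ∧ StrictMono f}

/-- The Murua coefficient `ω(t) = ∑_{k = 1}^{|t|} (-1)^{k+1} / k * ω_k(t)`. -/
noncomputable def murua (t : PlanarTree) : ℚ :=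
  ∑ k ∈ Finset.Icc 1 (Fintype.card t.Vertex), (-1 : ℚ) ^ (k + 1) / (k : ℚ) * (t.muruaCount k : ℚ)

/-! ### Schröder trees -/

/-- A Schröder tree is a planar rooted tree in which every vertex is either a leaf or has at least
two children. -/
inductive IsSchroder : PlanarTree → Prop
  | node (ts : List PlanarTree) (h : ts = [] ∨ 2 ≤ ts.length) (hts : ∀ t ∈ ts, IsSchroder t) :
      IsSchroder (node ts)

mutual
/-- The skeleton of a tree: the planar rooted tree formed by its internal vertices, obtained by
deleting all leaves. (Relevant only if the root is internal.) -/
def skeleton : PlanarTree → PlanarTree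
  | node ts => node (skeletonList ts)
/-- The skeletons of those trees of a list which are not reduced to a leaf. -/
def skeletonList : List PlanarTree → List PlanarTree
  | [] => []
  | t :: ts => if t.isLeaf then skeletonList ts else skeleton t :: skeletonList ts
end

mutual
/-- The sectors between consecutive leaves of a tree, from left to right. A sector is recorded by
the (address of the) internal vertex whose corolla it belongs to: the sector between two
consecutive subtrees grafted to a vertex `v` belongs to the corolla with root `v`. -/
def sectors : PlanarTree → List (List ℕ)
  | node ts => sectorsFrom 0 ts
/-- The sectors of the root and of the subtrees grafted to it, for a list of such subtrees whose
numbering starts at `i`. -/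
def sectorsFrom : ℕ → List PlanarTree → List (List ℕ)
  | _, [] => []
  | i, [t] => (sectors t).map (fun p => i :: p)
  | i, t :: t' :: ts => (sectors t).map (fun p => i :: p) ++ [] :: sectorsFrom (i + 1) (t' :: ts)
end

theorem numLeaves_pos (t : PlanarTree) : 0 < t.numLeaves := by
  induction t using numLeaves.induct (motive_2 := fun _ => True) with
  | case1 => simp [numLeaves]
  | case2 t ts h _ => simp only [numLeaves]; omega
  | case3 => trivial
  | case4 => trivial

mutual
theorem length_sectors : ∀ t : PlanarTree, t.sectors.length + 1 = t.numLeaves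
  | node [] => by simp [sectors, sectorsFrom, numLeaves]
  | node (t :: ts) => by
    have h := length_sectorsFrom (t :: ts) 0 (List.cons_ne_nil _ _)
    simpa only [sectors, numLeaves, numLeavesList] using h
theorem length_sectorsFrom : ∀ (ts : List PlanarTree) (i : ℕ), ts ≠ [] →
    (sectorsFrom i ts).length + 1 = numLeavesList ts
  | [], _, h => absurd rfl h
  | [t], i, _ => by
    have h := length_sectors t
    simpa [sectorsFrom, numLeavesList] using h
  | t :: t' :: ts, i, _ => by
    have h := length_sectors t
    have h' := length_sectorsFrom (t' :: ts) (i + 1) (List.cons_ne_nil _ _)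
    simp only [sectorsFrom, numLeavesList, List.length_append, List.length_map,
      List.length_cons] at h' ⊢
    omega
end

theorem sectorsFrom_mem : ∀ (ts : List PlanarTree) (i j : ℕ) (p : List ℕ),
    j :: p ∈ sectorsFrom i ts → i ≤ j
  | [], _, _, _ => by simp [sectorsFrom]
  | [t], i, j, p => by
    simp only [sectorsFrom, List.mem_map]
    rintro ⟨q, -, h⟩
    simp only [List.cons.injEq] at h
    omega
  | t :: t' :: ts, i, j, p => by
    simp only [sectorsFrom, List.mem_append, List.mem_map, List.mem_cons]
    rintro (⟨q, -, h⟩ | h | h)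
    · simp only [List.cons.injEq] at h
      omega
    · simp at h
    · have := sectorsFrom_mem (t' :: ts) (i + 1) j p h
      omega

theorem sublist_map_prefix {l : List (List ℕ)} (i : ℕ)
    (hl : ∀ x y : List ℕ, [x, y, x].Sublist l → x <+: y) (x y : List ℕ)
    (h : [x, y, x].Sublist (l.map (fun p => i :: p))) : x <+: y := by
  obtain ⟨l', hl', e⟩ := List.sublist_map_iff.1 h
  rcases l' with _ | ⟨a, _ | ⟨b, _ | ⟨c, _ | ⟨d, l'⟩⟩⟩⟩ <;> simp at e
  obtain ⟨rfl, rfl, e⟩ := e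
  have : a = c := by simpa using e
  subst this
  simpa using hl a b hl'

mutual
/-- Between two sectors of the corolla at `x`, all sectors belong to descendants of `x`. -/
theorem sectors_prefix : ∀ (t : PlanarTree) (x y : List ℕ), [x, y, x].Sublist t.sectors → x <+: y
  | node ts, x, y => by
    simpa only [sectors] using sectorsFrom_prefix ts 0 x y
theorem sectorsFrom_prefix : ∀ (ts : List PlanarTree) (i : ℕ) (x y : List ℕ),
    [x, y, x].Sublist (sectorsFrom i ts) → x <+: y
  | [], i, x, y => by simp [sectorsFrom]
  | [t], i, x, y => by
    simp only [sectorsFrom]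
    exact sublist_map_prefix i (sectors_prefix t) x y
  | t :: t' :: ts, i, x, y => by
    have h₁ := sublist_map_prefix i (sectors_prefix t) x y
    have h₂ := sectorsFrom_prefix (t' :: ts) (i + 1) x y
    intro h
    rcases x with _ | ⟨j, p⟩
    · exact List.nil_prefix
    simp only [sectorsFrom] at h
    obtain ⟨s₁, s₂, e, hs₁, hs₂⟩ := List.sublist_append_iff.1 h
    rcases s₁ with _ | ⟨a, s₁⟩
    · simp only [List.nil_append] at e
      subst e
      rcases List.sublist_cons_iff.1 hs₂ with h | ⟨r, hr, -⟩
      · exact h₂ h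
      · simp at hr
    · simp only [List.cons_append, List.cons.injEq] at e
      obtain ⟨rfl, e⟩ := e
      have hj : j = i := by
        have := hs₁.subset List.mem_cons_self
        simp only [List.mem_map, List.cons.injEq] at this
        obtain ⟨_, _, h, _⟩ := this
        exact h.symm
      rcases List.eq_nil_or_concat s₂ with rfl | ⟨s, b, rfl⟩
      · simp only [List.append_nil] at e
        subst e
        exact h₁ hs₁
      · have hb : b = j :: p := by
          have := congrArg List.getLast? e
          simpa [eq_comm] using this
        subst hb
        have hm := hs₂.subset (a := j :: p) (by simp)
        simp only [List.mem_cons, reduceCtorEq, false_or] at hm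
        have := sectorsFrom_mem _ _ _ _ hm
        omega
end

end PlanarTree

open PlanarTree

/-- `SchroderTree n`: the Schröder trees with `n + 1` leaves. -/
def SchroderTree (n : ℕ) : Type := {t : PlanarTree // t.IsSchroder ∧ t.numLeaves = n + 1}

theorem PlanarTree.numLeavesList_ge_length :
    ∀ ts : List PlanarTree, ts.length ≤ numLeavesList ts
  | [] => by simp
  | t :: ts => by
    have := numLeaves_pos t
    have := numLeavesList_ge_length ts
    simp only [List.length_cons, numLeavesList]
    omega

theorem PlanarTree.numLeaves_add_length_le : ∀ (ts : List PlanarTree), ∀ t ∈ ts,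
    numLeaves t + ts.length ≤ numLeavesList ts + 1
  | [], t => by simp
  | s :: ts, t => by
    have h₁ := numLeaves_pos s
    have h₂ := numLeavesList_ge_length ts
    intro h
    simp only [List.length_cons, numLeavesList]
    rcases List.mem_cons.1 h with rfl | h
    · omega
    · have := numLeaves_add_length_le ts t h
      omega

theorem PlanarTree.finite_isSchroder (n : ℕ) :
    {t : PlanarTree | t.IsSchroder ∧ t.numLeaves ≤ n}.Finite := by
  induction n with
  | zero =>
    refine Set.Finite.subset Set.finite_empty ?_
    rintro t ⟨-, h⟩
    have := numLeaves_pos t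
    omega
  | succ n ih =>
    set S := {t : PlanarTree | t.IsSchroder ∧ t.numLeaves ≤ n}
    have : Finite S := ih
    have hf := ((List.finite_length_le S (n + 1)).image (List.map Subtype.val)).image
      PlanarTree.node
    refine hf.subset ?_
    rintro _ ⟨⟨ts, h, hts⟩, hn⟩
    refine ⟨ts, ?_, rfl⟩
    rcases ts with _ | ⟨s, ts⟩
    · exact ⟨[], by simp, rfl⟩
    · have hn' : numLeavesList (s :: ts) ≤ n + 1 := by simpa [numLeaves, numLeavesList] using hn
      have hlen := numLeavesList_ge_length (s :: ts)
      have h2 : 2 ≤ (s :: ts).length := by simpa using h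
      refine ⟨(s :: ts).attach.map (fun t => ⟨t.1, hts t.1 t.2, ?_⟩), ?_, ?_⟩
      · have := numLeaves_add_length_le _ t.1 t.2
        omega
      · simp only [Set.mem_ofPred_eq, List.length_map, List.length_attach]
        omega
      · rw [List.map_map]
        exact List.attach_map_subtype_val _

instance (n : ℕ) : Finite (SchroderTree n) :=
  Set.Finite.to_subtype ((finite_isSchroder (n + 1)).subset fun _ h => ⟨h.1, h.2.le⟩)

noncomputable instance (n : ℕ) : Fintype (SchroderTree n) := Fintype.ofFinite _

/-! ### Noncrossing partitions and their forests of nestings -/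

/-- A partition of `Fin n` is noncrossing if there are no `a < b < c < d` with `a, c` in one block
and `b, d` in another one. -/
def IsNoncrossing {n : ℕ} (π : Finpartition (univ : Finset (Fin n))) : Prop :=
  ∀ V ∈ π.parts, ∀ W ∈ π.parts, ∀ a ∈ V, ∀ b ∈ W, ∀ c ∈ V, ∀ d ∈ W,
    a < b → b < c → c < d → V = W

/-- The noncrossing partitions of an `n`-element chain. -/
def NC (n : ℕ) : Type := {π : Finpartition (univ : Finset (Fin n)) // IsNoncrossing π}

noncomputable instance (n : ℕ) : Fintype (NC n) := by
  classical
  exact inferInstanceAs (Fintype {π : Finpartition (univ : Finset (Fin n)) // IsNoncrossing π})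

namespace NC

variable {n : ℕ}

/-- The blocks of a noncrossing partition; they are the vertices of its forest of nestings. -/
def Block (π : NC n) : Type := {V : Finset (Fin n) // V ∈ π.1.parts}

instance (π : NC n) : Fintype π.Block :=
  inferInstanceAs (Fintype {V : Finset (Fin n) // V ∈ π.1.parts})

theorem le_of_nested {π : NC n} {V W : π.Block}
    (h : ∀ b ∈ W.1, ∃ a ∈ V.1, ∃ c ∈ V.1, a ≤ b ∧ b ≤ c) :
    V.1.min' (π.1.nonempty_of_mem_parts V.2) ≤ W.1.min' (π.1.nonempty_of_mem_parts W.2) := by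
  obtain ⟨a, ha, _, _, hab, _⟩ := h _ (W.1.min'_mem (π.1.nonempty_of_mem_parts W.2))
  exact (V.1.min'_le a ha).trans hab

/-- The nesting order on blocks: `V ≤ W` if and only if `W` is nested in `V`, i.e. every element
of `W` lies between the minimum and the maximum of `V`. -/
instance (π : NC n) : PartialOrder π.Block where
  le V W := ∀ b ∈ W.1, ∃ a ∈ V.1, ∃ c ∈ V.1, a ≤ b ∧ b ≤ c
  le_refl _ b hb := ⟨b, hb, b, hb, le_rfl, le_rfl⟩
  le_trans U V W h₁ h₂ b hb := by
    obtain ⟨a, ha, c, hc, hab, hbc⟩ := h₂ b hb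
    obtain ⟨a', ha', -, -, h, -⟩ := h₁ a ha
    obtain ⟨-, -, c', hc', -, h'⟩ := h₁ c hc
    exact ⟨a', ha', c', hc', h.trans hab, hbc.trans h'⟩
  le_antisymm V W h₁ h₂ := by
    have h := le_antisymm (le_of_nested h₁) (le_of_nested h₂)
    refine Subtype.ext (π.1.eq_of_mem_parts V.2 W.2
      (V.1.min'_mem (π.1.nonempty_of_mem_parts V.2)) ?_)
    rw [h]
    exact W.1.min'_mem _

end NC

open Classical in
/-- The tree factorial, for the rooted tree with root `v` formed by the elements `w ≥ v` of a
finite poset whose Hasse diagram is a rooted forest with minimal elements as roots. The trees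
grafted to the root `v` are those whose roots cover `v`, and
`t! = |t| * s₁! ⋯ sₘ!` if `t` is obtained by grafting `s₁, …, sₘ` to the root. -/
noncomputable def treeFactorial {P : Type} [PartialOrder P] [Fintype P] (v : P) : ℕ :=
  Fintype.card {w : P // v ≤ w} * ∏ w : {w : P // v ⋖ w}, treeFactorial w.1
termination_by Fintype.card {w : P // v ≤ w}
decreasing_by
  refine Fintype.card_lt_of_injective_of_notMem
    (fun u => (⟨u.1, w.2.lt.le.trans u.2⟩ : {u : P // v ≤ u})) ?_ (b := ⟨v, le_rfl⟩) ?_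
  · intro x y h
    exact Subtype.ext (congrArg (fun u => u.1) h)
  · rintro ⟨u, hu⟩
    have hu' : u.1 = v := congrArg (fun u => u.1) hu
    exact w.2.lt.not_ge (hu'.subst (motive := fun z => w.1 ≤ z) u.2)

open Classical in
/-- The factorial of a finite rooted forest (seen as a poset): the product of the factorials of its
trees, whose roots are the minimal elements. -/
noncomputable def forestFactorial (P : Type) [PartialOrder P] [Fintype P] : ℕ :=
  ∏ v : {v : P // IsMin v}, treeFactorial v.1

/-- The factorial `t(π)!` of the forest of nestings of a noncrossing partition: its vertices are
the blocks, and there is an edge from `V` to `W` if and only if `W` covers `V` in the nesting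
order. -/
noncomputable def NC.nestingFactorial {n : ℕ} (π : NC n) : ℕ := forestFactorial π.Block

theorem restrict_update {A : Type*} {n : ℕ}
    (π : Finpartition (univ : Finset (Fin n))) (a : Fin n → A) {V : Finset (Fin n)}
    (hV : V ∈ π.parts) {i : Fin n} (hi : i ∈ V) (z : A) :
    (fun j => Function.update a i z (V.orderEmbOfFin rfl j)) =
      Function.update (fun j => a (V.orderEmbOfFin rfl j)) ((V.orderIsoOfFin rfl).symm ⟨i, hi⟩) z ∧
    ∀ W ∈ π.parts.erase V, (fun j => Function.update a i z (W.orderEmbOfFin rfl j)) =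
      fun j => a (W.orderEmbOfFin rfl j) := by
  constructor
  · have h : V.orderEmbOfFin rfl ((V.orderIsoOfFin rfl).symm ⟨i, hi⟩) = i := by
      rw [← coe_orderIsoOfFin_apply, OrderIso.apply_symm_apply]
    have h' := Function.update_comp_eq_of_injective a (V.orderEmbOfFin rfl).injective
      ((V.orderIsoOfFin rfl).symm ⟨i, hi⟩) z
    rw [h] at h'
    exact h'
  · intro W hW
    funext j
    refine Function.update_of_ne ?_ _ _
    rintro rfl
    exact (mem_erase.1 hW).1 (π.eq_of_mem_parts (mem_erase.1 hW).2 hV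
      (orderEmbOfFin_mem W rfl j) hi)

/-- For a family of multilinear functionals `f_m` and a noncrossing partition `π`, the functional
`f_π(a) = ∏_{V ∈ π} f_{|V|}(a | V)`, where `a | V = (a_{i₁}, …, a_{iₛ})` for
`V = {i₁ < ⋯ < iₛ}`. -/
noncomputable def partitionFunctional {A : Type*} [AddCommGroup A] [Module ℂ A]
    (f : ∀ m : ℕ, MultilinearMap ℂ (fun _ : Fin m => A) ℂ) {n : ℕ} (π : NC n) :
    MultilinearMap ℂ (fun _ : Fin n => A) ℂ where
  toFun a := ∏ V ∈ π.1.parts, f V.card (fun i => a (V.orderEmbOfFin rfl i))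
  map_update_add' := by
    intro inst a i x y
    obtain rfl : inst = instDecidableEqFin n := Subsingleton.elim _ _
    obtain ⟨V, ⟨hV, hi⟩, -⟩ := π.1.existsUnique_mem (mem_univ i)
    have key := fun z => restrict_update π.1 a hV hi z
    simp only [← mul_prod_erase _ _ hV, (key _).1, MultilinearMap.map_update_add,
      prod_congr rfl fun W hW => congrArg (f W.card) ((key (x + y)).2 W hW),
      prod_congr rfl fun W hW => congrArg (f W.card) ((key x).2 W hW),
      prod_congr rfl fun W hW => congrArg (f W.card) ((key y).2 W hW), add_mul]
  map_update_smul' := by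
    intro inst a i c x
    obtain rfl : inst = instDecidableEqFin n := Subsingleton.elim _ _
    obtain ⟨V, ⟨hV, hi⟩, -⟩ := π.1.existsUnique_mem (mem_univ i)
    have key := fun z => restrict_update π.1 a hV hi z
    simp only [← mul_prod_erase _ _ hV, (key _).1, MultilinearMap.map_update_smul,
      prod_congr rfl fun W hW => congrArg (f W.card) ((key (c • x)).2 W hW),
      prod_congr rfl fun W hW => congrArg (f W.card) ((key x).2 W hW), smul_mul_assoc]

/-! ### Moments and monotone cumulants -/

/-- The multilinear functional `φ_n(a₁, …, aₙ) = φ(a₁ ⋯ aₙ)`. -/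
noncomputable def moment {A : Type*} [Ring A] [Algebra ℂ A] (φ : A →ₗ[ℂ] ℂ) (n : ℕ) :
    MultilinearMap ℂ (fun _ : Fin n => A) ℂ :=
  φ.compMultilinearMap (MultilinearMap.mkPiAlgebraFin ℂ n A)

open Classical in
/-- The monotone cumulants `h_n`, recursively defined by the monotone moment-cumulant relation
`φ_n = ∑_{π ∈ NC(n)} (1 / t(π)!) h_π`: the summand of the one-block partition is `h_n`, and the
other summands only involve `h_m` with `m < n`. -/
noncomputable def monotoneCumulant {A : Type*} [Ring A] [Algebra ℂ A] (φ : A →ₗ[ℂ] ℂ) (n : ℕ) :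
    MultilinearMap ℂ (fun _ : Fin n => A) ℂ :=
  moment φ n - ∑ π : {π : NC n // π.1.parts ≠ {univ}}, (1 / (π.1.nestingFactorial : ℂ)) •
    partitionFunctional (fun m => if m < n then monotoneCumulant φ m else 0) π.1

theorem NC.card_lt {n : ℕ} (π : NC n) (hπ : π.1.parts ≠ {univ}) {V : Finset (Fin n)}
    (hV : V ∈ π.1.parts) : V.card < n := by
  have h : V.card ≤ n := by simpa using V.card_le_univ
  refine lt_of_le_of_ne h fun e => hπ ?_
  have hu : V = univ := (card_eq_iff_eq_univ V).1 (by simpa using e)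
  subst hu
  refine eq_singleton_iff_unique_mem.2 ⟨hV, fun W hW => ?_⟩
  obtain ⟨x, hx⟩ := π.1.nonempty_of_mem_parts hW
  exact π.1.eq_of_mem_parts hW hV hx (mem_univ x)

theorem partitionFunctional_congr {A : Type*} [AddCommGroup A] [Module ℂ A]
    {f g : ∀ m : ℕ, MultilinearMap ℂ (fun _ : Fin m => A) ℂ} {n : ℕ} (π : NC n)
    (h : ∀ V ∈ π.1.parts, f V.card = g V.card) :
    partitionFunctional f π = partitionFunctional g π := by
  ext a
  exact prod_congr rfl fun V hV => by rw [h V hV]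

theorem partitionFunctional_of_parts_eq {A : Type*} [AddCommGroup A] [Module ℂ A]
    (f : ∀ m : ℕ, MultilinearMap ℂ (fun _ : Fin m => A) ℂ) {n : ℕ} (π : NC n)
    (hπ : π.1.parts = {univ}) : partitionFunctional f π = f n := by
  ext a
  have key : ∀ (k : ℕ) (hk : (univ : Finset (Fin n)).card = k),
      f (univ : Finset (Fin n)).card (fun i => a ((univ : Finset (Fin n)).orderEmbOfFin rfl i)) =
        f k (fun i => a ((univ : Finset (Fin n)).orderEmbOfFin hk i)) := by
    rintro k rfl
    rfl
  change ∏ V ∈ π.1.parts, f V.card (fun i => a (V.orderEmbOfFin rfl i)) = f n a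
  rw [hπ, prod_singleton, key n (by simp)]
  rw [← orderEmbOfFin_unique (f := id) (by simp) (fun x => by simp) strictMono_id]
  rfl

theorem NC.nestingFactorial_of_parts_eq {n : ℕ} (π : NC n) (hπ : π.1.parts = {univ}) :
    π.nestingFactorial = 1 := by
  have hs : Subsingleton π.Block := by
    constructor
    rintro ⟨V, hV⟩ ⟨W, hW⟩
    rw [hπ, mem_singleton] at hV hW
    subst hV hW
    rfl
  have hf : ∀ v : π.Block, treeFactorial v = 1 := by
    intro v
    rw [treeFactorial]
    have h₁ : IsEmpty {w : π.Block // v ⋖ w} := ⟨fun w => w.2.lt.ne (Subsingleton.elim _ _)⟩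
    classical
    have h₂ : Fintype.card {w : π.Block // v ≤ w} = 1 :=
      Fintype.card_eq_one_iff.2 ⟨⟨v, le_rfl⟩, fun w => Subtype.ext (Subsingleton.elim _ _)⟩
    rw [h₂, Finset.univ_eq_empty, prod_empty, one_mul]
  simp [nestingFactorial, forestFactorial, hf]

/-- The one-block partition. -/
theorem NC.exists_parts_eq {n : ℕ} (hn : 1 ≤ n) : ∃ π : NC n, π.1.parts = {univ} := by
  have : Nonempty (Fin n) := ⟨⟨0, hn⟩⟩
  refine ⟨⟨Finpartition.indiscrete univ_nonempty.ne_empty, ?_⟩, rfl⟩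
  intro V hV W hW
  simp only [Finpartition.indiscrete, mem_singleton] at hV hW
  intros
  rw [hV, hW]

/-- A family of functionals satisfies the monotone moment-cumulant relations. -/
def IsMonotoneCumulantFamily {A : Type*} [Ring A] [Algebra ℂ A] (φ : A →ₗ[ℂ] ℂ)
    (h : ∀ m : ℕ, MultilinearMap ℂ (fun _ : Fin m => A) ℂ) : Prop :=
  ∀ n : ℕ, 1 ≤ n → ∀ a : Fin n → A,
    moment φ n a = ∑ π : NC n, (1 / (π.nestingFactorial : ℂ)) * partitionFunctional h π a

open Classical in
theorem sum_NC_eq {n : ℕ} (hn : 1 ≤ n) {A : Type*} [AddCommGroup A] [Module ℂ A]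
    (h : ∀ m : ℕ, MultilinearMap ℂ (fun _ : Fin m => A) ℂ) (a : Fin n → A) :
    ∑ π : NC n, (1 / (π.nestingFactorial : ℂ)) * partitionFunctional h π a =
      h n a + ∑ π : {π : NC n // π.1.parts ≠ {univ}}, (1 / (π.1.nestingFactorial : ℂ)) *
        partitionFunctional (fun m => if m < n then h m else 0) π.1 a := by
  obtain ⟨π₁, h₁⟩ := NC.exists_parts_eq hn
  have h₂ : ∀ π : NC n, π.1.parts ≠ {univ} ↔ π ∈ ({π₁}ᶜ : Finset (NC n)) := by
    intro π
    rw [mem_compl, mem_singleton, not_iff_not, ← h₁]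
    exact ⟨fun e => Subtype.ext (Finpartition.ext e), fun e => by rw [e]⟩
  rw [Fintype.sum_eq_add_sum_compl π₁, π₁.nestingFactorial_of_parts_eq h₁,
    partitionFunctional_of_parts_eq h π₁ h₁, sum_subtype _ (fun π => (h₂ π).symm)]
  congr 1
  · simp
  · refine sum_congr rfl fun π _ => ?_
    rw [partitionFunctional_congr (f := h) π.1 fun V hV => ?_]
    rw [if_pos (π.1.card_lt π.2 hV)]

/-- The monotone cumulants satisfy the monotone moment-cumulant relations. -/
theorem isMonotoneCumulantFamily_monotoneCumulant {A : Type*} [Ring A] [Algebra ℂ A]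
    (φ : A →ₗ[ℂ] ℂ) : IsMonotoneCumulantFamily φ (monotoneCumulant φ) := by
  intro n hn a
  rw [sum_NC_eq hn, monotoneCumulant]
  simp

/-- The monotone cumulants are the only family satisfying these relations. -/
theorem IsMonotoneCumulantFamily.eq_monotoneCumulant {A : Type*} [Ring A] [Algebra ℂ A]
    {φ : A →ₗ[ℂ] ℂ} {h : ∀ m : ℕ, MultilinearMap ℂ (fun _ : Fin m => A) ℂ}
    (hh : IsMonotoneCumulantFamily φ h) {n : ℕ} (hn : 1 ≤ n) : h n = monotoneCumulant φ n := by
  classical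
  induction n using Nat.strong_induction_on with
  | _ n ih =>
    ext a
    have e₁ := hh n hn a
    have e₂ := isMonotoneCumulantFamily_monotoneCumulant φ n hn a
    rw [sum_NC_eq hn] at e₁ e₂
    have e₃ : ∀ π : {π : NC n // π.1.parts ≠ {univ}},
        partitionFunctional (fun m => if m < n then h m else 0) π.1 =
          partitionFunctional (fun m => if m < n then monotoneCumulant φ m else 0) π.1 := by
      intro π
      refine partitionFunctional_congr _ fun V hV => ?_
      have hlt := π.1.card_lt π.2 hV
      simp only [hlt, if_true]
      exact ih _ hlt (π.1.1.nonempty_of_mem_parts hV).card_pos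
    simp only [e₃] at e₁
    exact add_right_cancel (e₁.symm.trans e₂)

/-! ### The noncrossing partition of a Schröder tree -/

/-- The internal vertex `v` of a Schröder tree with `n + 1` leaves such that the `i`-th sector
belongs to the corolla with root `v`. -/
def SchroderTree.sectorVertex {n : ℕ} (t : SchroderTree n) (i : Fin n) : List ℕ :=
  t.1.sectors[i.1]'(by have := length_sectors t.1; have := t.2.2; omega)

theorem SchroderTree.sectorVertex_prefix {n : ℕ} (t : SchroderTree n) {i j k : Fin n}
    (hij : i < j) (hjk : j < k) (h : t.sectorVertex i = t.sectorVertex k) :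
    t.sectorVertex i <+: t.sectorVertex j := by
  have hlen : t.1.sectors.length = n := by
    have := length_sectors t.1
    have := t.2.2
    omega
  refine sectors_prefix t.1 _ _ ?_
  have hs : [t.sectorVertex i, t.sectorVertex j, t.sectorVertex k].Sublist t.1.sectors := by
    refine List.sublist_iff_exists_fin_orderEmbedding_get_eq.2
      ⟨OrderEmbedding.ofStrictMono (fun m : Fin 3 => Fin.cast hlen.symm (![i, j, k] m)) ?_, ?_⟩
    · intro x y hxy
      have hik := hij.trans hjk
      fin_cases x <;> fin_cases y <;> simp_all
    · intro m
      fin_cases m <;> rfl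
  rwa [← h] at hs

open Classical in
/-- The partition `π(t)` of the sectors of a Schröder tree with `n + 1` leaves: for each internal
vertex `v`, the sectors belonging to the corolla with root `v` form a block. -/
noncomputable def SchroderTree.partition {n : ℕ} (t : SchroderTree n) : NC n :=
  ⟨Finpartition.ofSetoid (Setoid.ker t.sectorVertex), by
    intro V hV W hW a ha b hb c hc d hd hab hbc hcd
    have hrel : ∀ U ∈ (Finpartition.ofSetoid (Setoid.ker t.sectorVertex)).parts, ∀ x ∈ U,
        ∀ y, y ∈ U ↔ t.sectorVertex x = t.sectorVertex y := by
      intro U hU x hx y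
      rw [← Finpartition.part_eq_of_mem _ hU hx, Finpartition.mem_part_ofSetoid_iff_rel]
      rfl
    have hac := (hrel V hV a ha c).1 hc
    have hbd := (hrel W hW b hb d).1 hd
    have h₁ := t.sectorVertex_prefix hab hbc hac
    have h₂ := t.sectorVertex_prefix hbc hcd hbd
    rw [← hac] at h₂
    have h := h₁.eq_of_length (le_antisymm h₁.length_le h₂.length_le)
    exact Finpartition.eq_of_mem_parts _ hV hW ((hrel V hV a ha b).2 h) hb⟩

-- Fix a word and let D be the matrix, indexed by finite sets of positions, that passes from `U` to
-- `U ∪ V` with weight h(V) whenever the nonempty block `V` avoids `U` and lies in one gap of `U`.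
-- Every step enlarges the set, so the entries of exp(xD) are polynomials in x: `expTerm` is D^k/k!
-- and `expKernel` is exp(xD).
--
-- Three facts carry the proof. (1) A path of k steps from ∅ to `T` inserts the blocks of a
-- noncrossing partition, outer blocks before inner ones. By the hook length formula for forests,
-- the number of such orders divided by k! is 1/t(π)!, so the moment-cumulant relation says
-- exp(D)(∅,T) = φ(T) (`expTerm_eq_sum_ncPartitions`, `IsMonotoneCumulantFamily.expKernel_one`). (2)
-- The gaps of `U` evolve independently, so exp(xD)(U,T) is a product over the gaps
-- (`expKernel_cut`). (3) exp((x+y)D) = exp(xD) exp(yD) (`expKernel_add`).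
--
-- Hence exp((N+1)D)(∅,T) is the sum over S ⊆ T of φ(S) times the product, over the gaps of S, of
-- the entries of exp(ND) that start from ∅. This is also the recursion for Schröder trees whose
-- internal vertices are labelled strictly increasingly by N+1 labels: either the smallest label is
-- unused (S = ∅), or it sits at the root alone, S is the set of sectors of the root, and the
-- subtrees in the gaps use the other N labels. So exp(ND)(∅,T) is the sum over t of Ω(N) φ_{π(t)},
-- where Ω counts the strict labellings of sk(t) (`treeSum_eq_expKernel`).
--
-- Both sides are polynomials in N. The linear coefficient is h(T) on the left. On the right Ω(N) is
-- the sum of ω_k C(N,k), and C(N,k) has linear coefficient (-1)^{k+1}/k, which produces the Murua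
-- coefficient.

/-! ### Adding blocks one at a time -/

/-- No element of `U` lies strictly between two elements of `V`. -/
def Unseparated (U V : Finset ℕ) : Prop :=
  ∀ u ∈ U, ∀ a ∈ V, ∀ c ∈ V, a < u → ¬ u < c

open Classical in
/-- The nonempty subsets of `T \ U` that lie in a single gap of `U`. -/
noncomputable def gapSubsets (U T : Finset ℕ) : Finset (Finset ℕ) :=
  (T \ U).powerset.filter fun V => V.Nonempty ∧ Unseparated U V

theorem mem_gapSubsets {U T V : Finset ℕ} :
    V ∈ gapSubsets U T ↔ V ⊆ T \ U ∧ V.Nonempty ∧ Unseparated U V := by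
  simp [gapSubsets]

/-- The `k`-th term of the exponential of the kernel that adds to `U` a block `V` lying in a single
gap of `U`, with weight `h V`. -/
noncomputable def expTerm (h : Finset ℕ → ℂ) : ℕ → Finset ℕ → Finset ℕ → ℂ
  | 0, U, T => if U = T then 1 else 0
  | k + 1, U, T => ((k : ℂ) + 1)⁻¹ * ∑ V ∈ gapSubsets U T, h V * expTerm h k (U ∪ V) T

section expTerm

variable (h : Finset ℕ → ℂ)

theorem succ_mul_expTerm (k : ℕ) (U T : Finset ℕ) :
    ((k : ℂ) + 1) * expTerm h (k + 1) U T =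
      ∑ V ∈ gapSubsets U T, h V * expTerm h k (U ∪ V) T := by
  rw [expTerm, mul_inv_cancel_left₀ (Nat.cast_add_one_ne_zero k)]

theorem expTerm_of_not_subset {k : ℕ} {U T : Finset ℕ} (hU : ¬ U ⊆ T) : expTerm h k U T = 0 := by
  induction k generalizing U with
  | zero => exact if_neg fun e => hU e.subset
  | succ k ih =>
    rw [expTerm, sum_eq_zero fun V _ => ?_, mul_zero]
    rw [ih fun e => hU (subset_union_left.trans e), mul_zero]

theorem expTerm_of_card_lt {k : ℕ} {U T : Finset ℕ} (hk : T.card < U.card + k) :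
    expTerm h k U T = 0 := by
  induction k generalizing U with
  | zero => exact if_neg fun e => by subst e; omega
  | succ k ih =>
    rw [expTerm, sum_eq_zero fun V hV => ?_, mul_zero]
    obtain ⟨hs, hne, -⟩ := mem_gapSubsets.1 hV
    have hd : Disjoint U V := (disjoint_sdiff.mono_right hs)
    have := hne.card_pos
    rw [ih, mul_zero]
    rw [card_union_of_disjoint hd]
    omega

/-- This is D^{j+k} = D^j D^k after division by factorials. The induction peels off the first block
added, as in the recursion for `expTerm`. -/
theorem choose_mul_expTerm_add (j k : ℕ) (U T : Finset ℕ) :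
    ((j + k).choose j : ℂ) * expTerm h (j + k) U T =
      ∑ S ∈ T.powerset, expTerm h j U S * expTerm h k S T := by
  induction j generalizing U with
  | zero =>
    simp only [Nat.choose_zero_right, Nat.cast_one, one_mul, zero_add, expTerm, ite_mul, zero_mul,
      sum_ite_eq, mem_powerset]
    split_ifs with hU
    · rfl
    · exact expTerm_of_not_subset h hU
  | succ j ih =>
    have hj : (j : ℂ) + 1 ≠ 0 := Nat.cast_add_one_ne_zero j
    apply mul_left_cancel₀ hj
    rw [mul_sum]
    have key : ∀ S ∈ T.powerset,
        ((j : ℂ) + 1) * (expTerm h (j + 1) U S * expTerm h k S T) =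
          ∑ V ∈ gapSubsets U T, h V * (expTerm h j (U ∪ V) S * expTerm h k S T) := by
      intro S hS
      rw [← mul_assoc, succ_mul_expTerm, sum_mul]
      rw [sum_congr rfl fun V _ => mul_assoc _ _ _]
      -- Letting `V` range over the gaps inside `T` rather than inside `S` only adds blocks not
      -- contained in `S`, and from `U ∪ V` such an `S` cannot be reached.
      refine sum_subset ?_ ?_
      · intro V hV
        rw [mem_gapSubsets] at hV ⊢
        exact ⟨hV.1.trans (sdiff_subset_sdiff (mem_powerset.1 hS) subset_rfl), hV.2⟩
      · intro V hV hV'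
        rw [expTerm_of_not_subset h, zero_mul, mul_zero]
        intro hs
        rw [mem_gapSubsets] at hV hV'
        refine hV' ⟨fun x hx => mem_sdiff.2 ⟨hs (mem_union_right _ hx), ?_⟩, hV.2⟩
        exact (mem_sdiff.1 (hV.1 hx)).2
    rw [sum_congr rfl key, sum_comm]
    simp only [← mul_sum, ← ih]
    have e : j + 1 + k = j + k + 1 := by omega
    -- Absorption identity: the factor `j + 1` becomes the factor `j + k + 1` required by the
    -- recursion.
    have hc : ((j : ℂ) + 1) * ((j + 1 + k).choose (j + 1) : ℂ) =
        ((j + k).choose j : ℂ) * ((j + k : ℕ) + 1 : ℂ) := by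
      have := Nat.add_one_mul_choose_eq (j + k) j
      rw [e]
      have h' : (((j + k + 1) * (j + k).choose j : ℕ) : ℂ) =
        (((j + k + 1).choose (j + 1) * (j + 1) : ℕ) : ℂ) := by exact_mod_cast this
      push_cast at h' ⊢
      linear_combination -h'
    rw [← mul_assoc, hc, e, mul_assoc, succ_mul_expTerm, mul_sum]
    exact sum_congr rfl fun V _ => by ring

/-- A block in one gap of `U` cannot straddle the element `u` of `U`, so it lies entirely on one
side, where only the part of `U` on that side can separate it. -/
theorem gapSubsets_cut {U T : Finset ℕ} {u : ℕ} (hu : u ∈ U) :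
    gapSubsets U T = gapSubsets (U.filter (· < u)) (T.filter (· < u)) ∪
      gapSubsets (U.filter (u < ·)) (T.filter (u < ·)) := by
  ext V
  simp only [mem_union, mem_gapSubsets]
  constructor
  · rintro ⟨hs, hne, hsep⟩
    obtain ⟨x, hx⟩ := hne
    have hVu : ∀ y ∈ V, y ≠ u := fun y hy e => (mem_sdiff.1 (hs hy)).2 (e ▸ hu)
    rcases lt_or_gt_of_ne (hVu x hx) with hxu | hxu
    · left
      have hall : ∀ y ∈ V, y < u := fun y hy => lt_of_le_of_ne
        (not_lt.1 fun h' => hsep u hu x hx y hy hxu h') (hVu y hy)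
      refine ⟨fun y hy => ?_, ⟨x, hx⟩, fun v hv => hsep v (mem_filter.1 hv).1⟩
      have := mem_sdiff.1 (hs hy)
      simp [this, hall y hy]
    · right
      have hall : ∀ y ∈ V, u < y := fun y hy => lt_of_le_of_ne
        (not_lt.1 fun h' => hsep u hu y hy x hx h' hxu) (hVu y hy).symm
      refine ⟨fun y hy => ?_, ⟨x, hx⟩, fun v hv => hsep v (mem_filter.1 hv).1⟩
      have := mem_sdiff.1 (hs hy)
      simp [this, hall y hy]
  · rintro (⟨hs, hne, hsep⟩ | ⟨hs, hne, hsep⟩)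
    all_goals
      have hV : ∀ y ∈ V, y ∈ T ∧ y ∉ U := fun y hy => by
        have := hs hy
        simp only [mem_sdiff, mem_filter] at this
        tauto
      refine ⟨fun y hy => mem_sdiff.2 (hV y hy), hne, fun v hv a ha c hc hav hvc => ?_⟩
      have h₁ := hs ha
      have h₂ := hs hc
      simp only [mem_sdiff, mem_filter] at h₁ h₂
      exact hsep v (mem_filter.2 ⟨hv, by omega⟩) a ha c hc hav hvc

/-- The kernel factorizes over the gaps of `U`. -/
theorem expTerm_cut {U T : Finset ℕ} {u : ℕ} (hu : u ∈ U) (huT : u ∈ T) (k : ℕ) :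
    expTerm h k U T = ∑ p ∈ antidiagonal k,
      expTerm h p.1 (U.filter (· < u)) (T.filter (· < u)) *
        expTerm h p.2 (U.filter (u < ·)) (T.filter (u < ·)) := by
  induction k generalizing U with
  | zero =>
    simp only [Finset.Nat.antidiagonal_zero, sum_singleton, expTerm, ← ite_and, mul_ite, mul_one, mul_zero]
    refine if_congr ⟨?_, ?_⟩ rfl rfl
    · rintro rfl
      exact ⟨rfl, rfl⟩
    · rintro ⟨h₁, h₂⟩
      ext x
      have e₁ := Finset.ext_iff.1 h₁ x
      have e₂ := Finset.ext_iff.1 h₂ x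
      simp only [mem_filter] at e₁ e₂
      rcases lt_trichotomy x u with hx | rfl | hx
      · simpa [hx] using e₂
      · simp [hu, huT]
      · simpa [hx] using e₁
  | succ k ih =>
    apply mul_left_cancel₀ (Nat.cast_add_one_ne_zero k : (k : ℂ) + 1 ≠ 0)
    rw [succ_mul_expTerm, gapSubsets_cut hu, sum_union]
    swap
    · rw [disjoint_left]
      intro V h₁ h₂
      rw [mem_gapSubsets] at h₁ h₂
      obtain ⟨x, hx⟩ := h₁.2.1
      have e₁ := h₁.1 hx
      have e₂ := h₂.1 hx
      simp only [mem_sdiff, mem_filter] at e₁ e₂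
      omega
    set a := fun i => expTerm h i (U.filter (· < u)) (T.filter (· < u)) with ha
    set b := fun i => expTerm h i (U.filter (u < ·)) (T.filter (u < ·)) with hb
    -- A first block to the left of `u` advances only the left factor; `e₂` is the mirror statement.
    -- Together they are the Leibniz rule for D on the product of the two sides.
    have e₁ : ∑ V ∈ gapSubsets (U.filter (· < u)) (T.filter (· < u)),
        h V * expTerm h k (U ∪ V) T =
        ∑ p ∈ antidiagonal k, ((p.1 : ℂ) + 1) * a (p.1 + 1) * b p.2 := by
      simp only [ha, hb, succ_mul_expTerm, sum_mul]
      rw [sum_comm]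
      refine sum_congr rfl fun V hV => ?_
      have hV' : ∀ x ∈ V, x < u := fun x hx => by
        have := (mem_gapSubsets.1 hV).1 hx
        simp only [mem_sdiff, mem_filter] at this
        omega
      rw [ih (mem_union_left _ hu), mul_sum]
      refine sum_congr rfl fun p _ => ?_
      rw [filter_union, filter_union, filter_true_of_mem hV', filter_false_of_mem (s := V)
        (p := (u < ·)) (fun x hx => (hV' x hx).asymm), union_empty, mul_assoc]
    have e₂ : ∑ V ∈ gapSubsets (U.filter (u < ·)) (T.filter (u < ·)),
        h V * expTerm h k (U ∪ V) T =
        ∑ p ∈ antidiagonal k, ((p.2 : ℂ) + 1) * (a p.1 * b (p.2 + 1)) := by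
      have hp : ∀ p : ℕ × ℕ, ((p.2 : ℂ) + 1) * (a p.1 * b (p.2 + 1)) =
          ∑ V ∈ gapSubsets (U.filter (u < ·)) (T.filter (u < ·)), a p.1 *
            (h V * expTerm h p.2 (U.filter (u < ·) ∪ V) (T.filter (u < ·))) := fun p => by
        rw [mul_left_comm, ← mul_sum, ← succ_mul_expTerm]
      rw [sum_congr rfl fun p _ => hp p, sum_comm]
      refine sum_congr rfl fun V hV => ?_
      have hV' : ∀ x ∈ V, u < x := fun x hx => by
        have := (mem_gapSubsets.1 hV).1 hx
        simp only [mem_sdiff, mem_filter] at this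
        omega
      rw [ih (mem_union_left _ hu), mul_sum]
      refine sum_congr rfl fun p _ => ?_
      rw [filter_union, filter_union, filter_true_of_mem hV', filter_false_of_mem (s := V)
        (p := (· < u)) (fun x hx => (hV' x hx).asymm), union_empty, mul_left_comm]
    rw [e₁, e₂]
    -- Write `k + 1 = p.1 + p.2` in each term. When the indices are then shifted, the boundary terms
    -- drop out because their coefficient is zero.
    have e₃ : ((k : ℂ) + 1) * ∑ p ∈ antidiagonal (k + 1), a p.1 * b p.2 =
        ∑ p ∈ antidiagonal (k + 1), (p.1 : ℂ) * a p.1 * b p.2 +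
        ∑ p ∈ antidiagonal (k + 1), (p.2 : ℂ) * (a p.1 * b p.2) := by
      rw [← sum_add_distrib, mul_sum]
      refine sum_congr rfl fun p hp => ?_
      have : ((p.1 + p.2 : ℕ) : ℂ) = (k + 1 : ℕ) := by rw [HasAntidiagonal.mem_antidiagonal.1 hp]
      push_cast at this
      rw [← this]
      ring
    rw [e₃, Finset.Nat.sum_antidiagonal_succ (f := fun p => (p.1 : ℂ) * a p.1 * b p.2),
      Finset.Nat.sum_antidiagonal_succ' (f := fun p => (p.2 : ℂ) * (a p.1 * b p.2))]
    simp

-- The one-parameter semigroup generated by the block-adding kernel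

/-- The exponential of `x` times the kernel that adds a block. -/
noncomputable def expKernel (x : ℂ) (U T : Finset ℕ) : ℂ :=
  ∑ k ∈ range (T.card + 1), expTerm h k U T * x ^ k

theorem expKernel_eq_sum_range {B : ℕ} {T : Finset ℕ} (hB : T.card < B) (x : ℂ) (U : Finset ℕ) :
    expKernel h x U T = ∑ k ∈ range B, expTerm h k U T * x ^ k := by
  refine sum_subset (range_subset_range.2 hB) fun k _ hk => ?_
  rw [mem_range] at hk
  rw [expTerm_of_card_lt h (by omega), zero_mul]

/-- Cauchy product of truncated series: the terms of the square outside the triangle `i + j < B`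
vanish by hypothesis. -/
theorem sum_range_mul_sum_range_eq {B : ℕ} (f g : ℕ → ℂ)
    (hfg : ∀ i j, B ≤ i + j → f i * g j = 0) :
    (∑ i ∈ range B, f i) * ∑ j ∈ range B, g j =
      ∑ k ∈ range B, ∑ p ∈ antidiagonal k, f p.1 * g p.2 := by
  rw [sum_mul_sum, ← sum_product', sum_sigma']
  symm
  refine sum_of_injOn (fun p => p.2) ?_ ?_ ?_ (fun _ _ => rfl)
  · rintro ⟨k, i, j⟩ h₁ ⟨l, i', j'⟩ h₂ e
    simp only [coe_sigma, Set.mem_sigma_iff, mem_coe, HasAntidiagonal.mem_antidiagonal] at h₁ h₂ e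
    simp only [Prod.mk.injEq] at e
    obtain ⟨rfl, rfl⟩ := e
    obtain ⟨-, rfl⟩ := h₁
    obtain ⟨-, rfl⟩ := h₂
    rfl
  · rintro ⟨k, i, j⟩ h₁
    simp only [coe_sigma, Set.mem_sigma_iff, mem_coe, HasAntidiagonal.mem_antidiagonal, mem_range] at h₁
    simp only [coe_product, Set.mem_prod, mem_coe, mem_range]
    omega
  · rintro ⟨i, j⟩ - h₂
    apply hfg
    by_contra hlt
    refine h₂ ⟨⟨i + j, i, j⟩, ?_, rfl⟩
    simp only [coe_sigma, Set.mem_sigma_iff, mem_coe, HasAntidiagonal.mem_antidiagonal, mem_range]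
    exact ⟨not_le.1 hlt, trivial⟩

/-- Multiplies the identities `expTerm_cut` by powers of `x` and sums. The truncations are
compatible because the two sides of `u` have at most `T.card` elements in total. -/
theorem expKernel_cut (x : ℂ) {U T : Finset ℕ} {u : ℕ} (hu : u ∈ U) (huT : u ∈ T) :
    expKernel h x U T = expKernel h x (U.filter (· < u)) (T.filter (· < u)) *
      expKernel h x (U.filter (u < ·)) (T.filter (u < ·)) := by
  have hT : (T.filter (· < u)).card + (T.filter (u < ·)).card ≤ T.card := by
    rw [← card_union_of_disjoint]
    · exact card_le_card (union_subset (filter_subset _ _) (filter_subset _ _))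
    · rw [disjoint_left]
      intro y h₁ h₂
      simp only [mem_filter] at h₁ h₂
      omega
  rw [expKernel_eq_sum_range h (B := T.card + 1) (T := T.filter (· < u)) (by omega),
    expKernel_eq_sum_range h (B := T.card + 1) (T := T.filter (u < ·)) (by omega),
    sum_range_mul_sum_range_eq]
  · rw [expKernel]
    refine sum_congr rfl fun k _ => ?_
    rw [expTerm_cut h hu huT, sum_mul]
    refine sum_congr rfl fun p hp => ?_
    rw [← HasAntidiagonal.mem_antidiagonal.1 hp, pow_add]
    ring
  · intro i j hij
    by_cases hi : (T.filter (· < u)).card < i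
    · rw [expTerm_of_card_lt h (by omega), zero_mul, zero_mul]
    · rw [expTerm_of_card_lt h (k := j) (by omega), zero_mul, mul_zero]

/-- The binomial theorem for (x + y)^k absorbs the binomial coefficients of
`choose_mul_expTerm_add`. -/
theorem expKernel_add (x y : ℂ) (U T : Finset ℕ) :
    expKernel h (x + y) U T = ∑ S ∈ T.powerset, expKernel h x U S * expKernel h y S T := by
  have key : ∀ S ∈ T.powerset, expKernel h x U S * expKernel h y S T =
      ∑ k ∈ range (T.card + 1), ∑ p ∈ antidiagonal k,
        (expTerm h p.1 U S * x ^ p.1) * (expTerm h p.2 S T * y ^ p.2) := by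
    intro S hS
    have hc := card_le_card (mem_powerset.1 hS)
    rw [expKernel_eq_sum_range h (B := T.card + 1) (T := S) (by omega), expKernel,
      sum_range_mul_sum_range_eq]
    intro i j hij
    by_cases hi : S.card < i
    · rw [expTerm_of_card_lt h (by omega), zero_mul, zero_mul]
    · rw [expTerm_of_card_lt h (k := j) (by omega), zero_mul, mul_zero]
  rw [sum_congr rfl key, sum_comm, expKernel]
  refine sum_congr rfl fun k _ => ?_
  rw [sum_comm, (Commute.all x y).add_pow', mul_sum]
  refine sum_congr rfl fun p hp => ?_
  rw [← HasAntidiagonal.mem_antidiagonal.1 hp, nsmul_eq_mul, ← mul_assoc, mul_comm (expTerm _ _ _ _),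
    choose_mul_expTerm_add, sum_mul]
  exact sum_congr rfl fun S _ => by ring

theorem expKernel_zero (U T : Finset ℕ) : expKernel h 0 U T = if U = T then 1 else 0 := by
  rw [expKernel, sum_range_succ']
  simp [expTerm]

/-- The only single block leading from the empty set to `T` is `T` itself. This is how the cumulant
is recovered as a linear coefficient. -/
theorem expTerm_one {T : Finset ℕ} (hT : T.Nonempty) : expTerm h 1 ∅ T = h T := by
  simp only [expTerm, empty_union, mul_ite, mul_one, mul_zero, Nat.cast_zero, zero_add, inv_one,
    one_mul, sum_ite_eq']
  exact if_pos (mem_gapSubsets.2 ⟨by simp, hT, fun u hu => by simp at hu⟩)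

end expTerm

/-! ### Noncrossing partitions of finite sets of integers -/

/-- Every element of `W` lies between two elements of `V`. -/
def Nested {ι : Type*} [LinearOrder ι] (V W : Finset ι) : Prop :=
  ∀ b ∈ W, ∃ a ∈ V, ∃ c ∈ V, a ≤ b ∧ b ≤ c

theorem Nested.refl {ι : Type*} [LinearOrder ι] (V : Finset ι) : Nested V V :=
  fun b hb => ⟨b, hb, b, hb, le_rfl, le_rfl⟩

theorem Nested.trans {ι : Type*} [LinearOrder ι] {V W X : Finset ι} (h₁ : Nested V W)
    (h₂ : Nested W X) : Nested V X := by
  intro b hb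
  obtain ⟨a, ha, c, hc, hab, hbc⟩ := h₂ b hb
  obtain ⟨a', ha', -, -, h, -⟩ := h₁ a ha
  obtain ⟨-, -, c', hc', -, h'⟩ := h₁ c hc
  exact ⟨a', ha', c', hc', h.trans hab, hbc.trans h'⟩

open Classical in
/-- The product of the hook lengths of the nesting order on a family of blocks. -/
noncomputable def hookProd {ι : Type*} [LinearOrder ι] (P : Finset (Finset ι)) : ℕ :=
  ∏ V ∈ P, (P.filter fun W => Nested V W).card

/-- `P` is a noncrossing partition of `T \ U` whose blocks lie in gaps of `U`. -/
structure IsNCPartition (U T : Finset ℕ) (P : Finset (Finset ℕ)) : Prop where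
  nonempty : ∀ V ∈ P, V.Nonempty
  eq_of_mem : ∀ V ∈ P, ∀ W ∈ P, ∀ x ∈ V, x ∈ W → V = W
  mem_iff : ∀ x, x ∈ T \ U ↔ ∃ V ∈ P, x ∈ V
  noncrossing : ∀ V ∈ P, ∀ W ∈ P, ∀ a ∈ V, ∀ b ∈ W, ∀ c ∈ V, ∀ d ∈ W,
    a < b → b < c → c < d → V = W
  unseparated : ∀ V ∈ P, Unseparated U V

namespace IsNCPartition

variable {U T : Finset ℕ} {P : Finset (Finset ℕ)} (hP : IsNCPartition U T P)
include hP

theorem nested_antisymm {V W : Finset ℕ} (hV : V ∈ P) (hW : W ∈ P) (h₁ : Nested V W)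
    (h₂ : Nested W V) : V = W := by
  have h : V.min' (hP.nonempty V hV) = W.min' (hP.nonempty W hW) := by
    apply le_antisymm
    · obtain ⟨a, ha, -, -, hab, -⟩ := h₁ _ (W.min'_mem (hP.nonempty W hW))
      exact (V.min'_le a ha).trans hab
    · obtain ⟨a, ha, -, -, hab, -⟩ := h₂ _ (V.min'_mem (hP.nonempty V hV))
      exact (W.min'_le a ha).trans hab
  exact hP.eq_of_mem V hV W hW _ (V.min'_mem (hP.nonempty V hV)) (h ▸ W.min'_mem _)

/-- Noncrossing makes the nesting order a forest: two blocks that surround a common block overlap as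
intervals, and overlapping without nesting would be a crossing. -/
theorem nested_or_nested {V W X : Finset ℕ} (hV : V ∈ P) (hW : W ∈ P) (hX : X ∈ P)
    (h₁ : Nested V X) (h₂ : Nested W X) : Nested V W ∨ Nested W V := by
  wlog hle : V.min' (hP.nonempty V hV) ≤ W.min' (hP.nonempty W hW) generalizing V W
  · exact (this hW hV h₂ h₁ (not_le.1 hle).le).symm
  by_cases he : V = W
  · exact Or.inl (he ▸ Nested.refl V)
  obtain ⟨b, hb⟩ := hP.nonempty X hX
  obtain ⟨-, -, c, hc, -, hbc⟩ := h₁ b hb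
  obtain ⟨a', ha', -, -, hab', -⟩ := h₂ b hb
  have hmv := V.min'_mem (hP.nonempty V hV)
  have hmw := W.min'_mem (hP.nonempty W hW)
  have hMv := V.max'_mem (hP.nonempty V hV)
  have hne : ∀ x ∈ V, ∀ y ∈ W, x ≠ y := fun x hx y hy e =>
    he (hP.eq_of_mem V hV W hW x hx (e ▸ hy))
  left
  intro y hy
  refine ⟨_, hmv, _, hMv, hle.trans (W.min'_le y hy), ?_⟩
  by_contra hlt
  have h₃ := W.min'_le a' ha'
  have h₄ := V.le_max' c hc
  have h₅ := hne _ hmv _ hmw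
  have h₆ := hne _ hMv _ hmw
  -- Since both blocks surround `b`, min W ≤ b ≤ max V; an element `y` of `W` beyond max V gives the
  -- crossing min V < min W < max V < y.
  exact he (hP.noncrossing V hV W hW _ hmv _ hmw _ hMv y hy (by omega) (by omega) (by omega))

open Classical in
theorem exists_root {W : Finset ℕ} (hW : W ∈ P) :
    ∃ V ∈ P, (∀ X ∈ P, Nested X V → X = V) ∧ Nested V W := by
  -- Among the blocks surrounding `W`, one with the most blocks nested in it is a root: any strictly
  -- larger block would contain these blocks and itself.
  obtain ⟨V, hV, hmax⟩ := exists_max_image (P.filter fun V => Nested V W)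
    (fun V => (P.filter fun X => Nested V X).card) ⟨W, by simp [hW, Nested.refl]⟩
  rw [mem_filter] at hV
  refine ⟨V, hV.1, fun X hX hXV => ?_, hV.2⟩
  by_contra hne
  have h₁ := hmax X (mem_filter.2 ⟨hX, hXV.trans hV.2⟩)
  refine h₁.not_gt (card_lt_card ((ssubset_iff_of_subset ?_).2 ⟨X, ?_, ?_⟩))
  · intro Y hY
    rw [mem_filter] at hY ⊢
    exact ⟨hY.1, hXV.trans hY.2⟩
  · simp [hX, Nested.refl]
  · rw [mem_filter]
    exact fun h => hne (hP.nested_antisymm hX hV.1 hXV h.2)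

open Classical in
/-- Every block lies above exactly one root of the forest of nestings. -/
theorem card_eq_sum_roots :
    P.card = ∑ V ∈ P.filter (fun V => ∀ X ∈ P, Nested X V → X = V),
      (P.filter fun W => Nested V W).card := by
  rw [← card_biUnion]
  · congr 1
    ext W
    simp only [mem_biUnion, mem_filter]
    constructor
    · intro hW
      obtain ⟨V, hV, hroot, hVW⟩ := hP.exists_root hW
      exact ⟨V, ⟨hV, hroot⟩, hW, hVW⟩
    · rintro ⟨V, -, hW, -⟩
      exact hW
  · intro V hV V' hV' hne
    refine disjoint_left.2 fun W h₁ h₂ => ?_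
    simp only [mem_coe, mem_filter] at hV hV' h₁ h₂
    rcases hP.nested_or_nested hV.1 hV'.1 h₁.1 h₁.2 h₂.2 with h | h
    · exact hne (hV'.2 V hV.1 h)
    · exact hne (hV.2 V' hV'.1 h).symm

omit hP in
open Classical in
-- A root is nested in no other block, so removing it leaves every other hook length unchanged.
theorem hookProd_eq_mul_erase {V : Finset ℕ} (hV : V ∈ P)
    (hroot : ∀ X ∈ P, Nested X V → X = V) :
    hookProd P = (P.filter fun W => Nested V W).card * hookProd (P.erase V) := by
  rw [hookProd, ← mul_prod_erase P _ hV, hookProd]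
  congr 1
  refine prod_congr rfl fun X hX => ?_
  congr 1
  ext Y
  simp only [mem_filter, mem_erase]
  constructor
  · rintro ⟨hY, hXY⟩
    refine ⟨⟨?_, hY⟩, hXY⟩
    rintro rfl
    exact (mem_erase.1 hX).1 (hroot X (mem_erase.1 hX).2 hXY)
  · rintro ⟨⟨-, hY⟩, hXY⟩
    exact ⟨hY, hXY⟩

open Classical in
-- The recursion behind the hook length formula: deleting a root multiplies the inverse hook product
-- by the hook of that root, and the hooks of the roots add up to the number of blocks.
theorem card_mul_inv_hookProd :
    (P.card : ℂ) * (hookProd P : ℂ)⁻¹ =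
      ∑ V ∈ P.filter (fun V => ∀ X ∈ P, Nested X V → X = V), (hookProd (P.erase V) : ℂ)⁻¹ := by
  rw [hP.card_eq_sum_roots, Nat.cast_sum, sum_mul]
  refine sum_congr rfl fun V hV => ?_
  rw [mem_filter] at hV
  rw [hookProd_eq_mul_erase hV.1 hV.2, Nat.cast_mul, mul_inv]
  refine mul_inv_cancel_left₀ ?_ _
  rw [Nat.cast_ne_zero, card_ne_zero]
  exact ⟨V, mem_filter.2 ⟨hV.1, Nested.refl V⟩⟩

theorem subset {V : Finset ℕ} (hV : V ∈ P) : V ⊆ T \ U :=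
  fun x hx => (hP.mem_iff x).2 ⟨V, hV, hx⟩

/-- With `insert_root` and `eq_of_nested_of_union`, this identifies the possible first blocks of an
insertion order with the roots of the forest of nestings. -/
theorem erase_root {V : Finset ℕ} (hV : V ∈ P) (hroot : ∀ X ∈ P, Nested X V → X = V) :
    IsNCPartition (U ∪ V) T (P.erase V) where
  nonempty W hW := hP.nonempty W (mem_erase.1 hW).2
  eq_of_mem W hW X hX := hP.eq_of_mem W (mem_erase.1 hW).2 X (mem_erase.1 hX).2
  mem_iff x := by
    have := hP.mem_iff x
    simp only [mem_sdiff, mem_union, mem_erase] at this ⊢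
    constructor
    · rintro ⟨hx, hx'⟩
      obtain ⟨W, hW, hxW⟩ := this.1 ⟨hx, fun h => hx' (Or.inl h)⟩
      exact ⟨W, ⟨fun e => hx' (Or.inr (e ▸ hxW)), hW⟩, hxW⟩
    · rintro ⟨W, ⟨hne, hW⟩, hxW⟩
      obtain ⟨h₁, h₂⟩ := this.2 ⟨W, hW, hxW⟩
      refine ⟨h₁, ?_⟩
      rintro (h | h)
      · exact h₂ h
      · exact hne (hP.eq_of_mem W hW V hV x hxW h)
  noncrossing W hW X hX := hP.noncrossing W (mem_erase.1 hW).2 X (mem_erase.1 hX).2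
  unseparated W hW := by
    obtain ⟨hne, hW⟩ := mem_erase.1 hW
    intro u hu a ha c hc hau huc
    rcases mem_union.1 hu with hu | hu
    · exact hP.unseparated W hW u hu a ha c hc hau huc
    -- If `u ∈ V` separates `a` from `c` in `W`, noncrossing traps all of `V` between `a` and `c`,
    -- so `W` would surround the root `V`.
    refine hne (hroot W hW fun x hx => ⟨a, ha, c, hc, ?_, ?_⟩)
    · by_contra hlt
      exact hne (hP.noncrossing V hV W hW x hx a ha u hu c hc (not_le.1 hlt) hau huc).symm
    · by_contra hlt
      exact hne (hP.noncrossing W hW V hV a ha u hu c hc x hx hau huc (not_le.1 hlt))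

omit hP in
theorem notMem_of_union {V : Finset ℕ} (hP : IsNCPartition (U ∪ V) T P) (hV : V.Nonempty) :
    V ∉ P := by
  intro h
  obtain ⟨x, hx⟩ := hV
  exact (mem_sdiff.1 (hP.subset h hx)).2 (mem_union_right _ hx)

omit hP in
theorem disjoint_of_union {V W : Finset ℕ} (hP : IsNCPartition (U ∪ V) T P) (hW : W ∈ P) :
    ∀ x ∈ V, ∀ y ∈ W, x ≠ y := by
  rintro x hx y hy rfl
  exact (mem_sdiff.1 (hP.subset hW hy)).2 (mem_union_right _ hx)

omit hP in
theorem insert_root {V : Finset ℕ} (hP : IsNCPartition (U ∪ V) T P) (hV : V ∈ gapSubsets U T) :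
    IsNCPartition U T (insert V P) := by
  obtain ⟨hs, hne, hsep⟩ := mem_gapSubsets.1 hV
  refine ⟨?_, ?_, ?_, ?_, ?_⟩
  · intro W hW
    rcases mem_insert.1 hW with rfl | hW
    · exact hne
    · exact hP.nonempty W hW
  · intro W hW X hX x hxW hxX
    rcases mem_insert.1 hW with rfl | hW' <;> rcases mem_insert.1 hX with rfl | hX'
    · rfl
    · exact absurd rfl (hP.disjoint_of_union hX' x hxW x hxX)
    · exact absurd rfl (hP.disjoint_of_union hW' x hxX x hxW)
    · exact hP.eq_of_mem W hW' X hX' x hxW hxX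
  · intro x
    have := hP.mem_iff x
    simp only [mem_sdiff, mem_union, not_or] at this
    rw [exists_mem_insert, ← this]
    constructor
    · intro h
      by_cases hx : x ∈ V
      · exact Or.inl hx
      · exact Or.inr ⟨(mem_sdiff.1 h).1, (mem_sdiff.1 h).2, hx⟩
    · rintro (h | h)
      · exact hs h
      · exact mem_sdiff.2 ⟨h.1, h.2.1⟩
  · intro W hW X hX a ha b hb c hc d hd hab hbc hcd
    rcases mem_insert.1 hW with rfl | hW' <;> rcases mem_insert.1 hX with rfl | hX'
    · rfl
    · exact absurd hcd (hP.unseparated X hX' c (mem_union_right _ hc) b hb d hd hbc)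
    · exact absurd hbc (hP.unseparated W hW' b (mem_union_right _ hb) a ha c hc hab)
    · exact hP.noncrossing W hW' X hX' a ha b hb c hc d hd hab hbc hcd
  · intro W hW
    rcases mem_insert.1 hW with rfl | hW
    · exact hsep
    · exact fun u hu => hP.unseparated W hW u (mem_union_left _ hu)

omit hP in
theorem eq_of_nested_of_union {V : Finset ℕ} (hP : IsNCPartition (U ∪ V) T P)
    (hne : V.Nonempty) : ∀ X ∈ insert V P, Nested X V → X = V := by
  intro X hX hXV
  rcases mem_insert.1 hX with rfl | hX
  · rfl
  obtain ⟨x, hx⟩ := hne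
  obtain ⟨a, ha, c, hc, hax, hxc⟩ := hXV x hx
  have h₁ := hP.disjoint_of_union hX x hx a ha
  have h₂ := hP.disjoint_of_union hX x hx c hc
  exact absurd (lt_of_le_of_ne hxc h₂) (hP.unseparated X hX x (mem_union_right _ hx) a ha c hc
    (lt_of_le_of_ne hax h₁.symm))

theorem root_mem_gapSubsets {V : Finset ℕ} (hV : V ∈ P) : V ∈ gapSubsets U T :=
  mem_gapSubsets.2 ⟨hP.subset hV, hP.nonempty V hV, hP.unseparated V hV⟩

end IsNCPartition

open Classical in
/-- The noncrossing partitions of `T \ U` whose blocks lie in gaps of `U`. -/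
noncomputable def ncPartitions (U T : Finset ℕ) : Finset (Finset (Finset ℕ)) :=
  (T \ U).powerset.powerset.filter (IsNCPartition U T)

theorem mem_ncPartitions {U T : Finset ℕ} {P : Finset (Finset ℕ)} :
    P ∈ ncPartitions U T ↔ IsNCPartition U T P := by
  classical
  rw [ncPartitions, mem_filter, and_iff_right_iff_imp]
  exact fun hP => mem_powerset.2 fun V hV => mem_powerset.2 (hP.subset hV)

/-- Hook length formula in weighted form. Both sides satisfy the same recursion: on the left a first
block in a gap of `U` is split off, on the right a root is removed from the partition. -/
theorem expTerm_eq_sum_ncPartitions (h : Finset ℕ → ℂ) (k : ℕ) {U T : Finset ℕ} (hU : U ⊆ T) :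
    expTerm h k U T = ∑ P ∈ (ncPartitions U T).filter (fun P => P.card = k),
      (hookProd P : ℂ)⁻¹ * ∏ V ∈ P, h V := by
  classical
  induction k generalizing U with
  | zero =>
    have hmem : ∅ ∈ ncPartitions U T ↔ U = T := by
      rw [mem_ncPartitions]
      constructor
      · intro hP
        refine hU.antisymm (sdiff_eq_empty_iff_subset.1 (eq_empty_of_forall_notMem fun x hx => ?_))
        simpa using (hP.mem_iff x).1 hx
      · rintro rfl
        exact ⟨by simp, by simp, by simp, by simp, by simp⟩
    have hf : (ncPartitions U T).filter (fun P => P.card = 0) = if U = T then {∅} else ∅ := by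
      ext P
      rw [mem_filter, card_eq_zero]
      split_ifs with e
      · rw [mem_singleton, and_iff_right_iff_imp]
        rintro rfl
        exact hmem.2 e
      · simp only [notMem_empty, iff_false]
        rintro ⟨h₁, rfl⟩
        exact e (hmem.1 h₁)
    rw [hf, expTerm]
    split_ifs
    · simp [hookProd]
    · simp
  | succ k ih =>
    apply mul_left_cancel₀ (Nat.cast_add_one_ne_zero k : (k : ℂ) + 1 ≠ 0)
    rw [succ_mul_expTerm, mul_sum]
    have key : ∀ P ∈ (ncPartitions U T).filter (fun P => P.card = k + 1),
        ((k : ℂ) + 1) * ((hookProd P : ℂ)⁻¹ * ∏ V ∈ P, h V) =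
          ∑ V ∈ P.filter (fun V => ∀ X ∈ P, Nested X V → X = V),
            h V * ((hookProd (P.erase V) : ℂ)⁻¹ * ∏ W ∈ P.erase V, h W) := by
      intro P hP
      obtain ⟨hP, hc⟩ := mem_filter.1 hP
      have hc' : (k : ℂ) + 1 = P.card := by rw [hc]; push_cast; rfl
      rw [hc', ← mul_assoc, (mem_ncPartitions.1 hP).card_mul_inv_hookProd, sum_mul]
      refine sum_congr rfl fun V hV => ?_
      rw [← mul_prod_erase P h (mem_filter.1 hV).1]
      ring
    rw [sum_congr rfl key]
    have key' : ∀ V ∈ gapSubsets U T, h V * expTerm h k (U ∪ V) T =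
        ∑ P ∈ (ncPartitions (U ∪ V) T).filter (fun P => P.card = k),
          h V * ((hookProd P : ℂ)⁻¹ * ∏ W ∈ P, h W) := by
      intro V hV
      rw [ih (union_subset hU ((mem_gapSubsets.1 hV).1.trans sdiff_subset)), mul_sum]
    rw [sum_congr rfl key', sum_sigma', sum_sigma']
    -- A first block with a partition of what remains is the same as a partition with a marked root.
    refine sum_bij' (fun p _ => ⟨insert p.1 p.2, p.1⟩) (fun q _ => ⟨q.2, q.1.erase q.2⟩)
      ?_ ?_ ?_ ?_ ?_
    · rintro ⟨V, P⟩ hp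
      simp only [mem_sigma, mem_filter, mem_ncPartitions] at hp ⊢
      obtain ⟨hV, hP, hc⟩ := hp
      have hne := (mem_gapSubsets.1 hV).2.1
      exact ⟨⟨hP.insert_root hV, by rw [card_insert_of_notMem (hP.notMem_of_union hne), hc]⟩,
        mem_insert_self _ _, hP.eq_of_nested_of_union hne⟩
    · rintro ⟨P, V⟩ hp
      simp only [mem_sigma, mem_filter, mem_ncPartitions] at hp ⊢
      obtain ⟨⟨hP, hc⟩, hV, hroot⟩ := hp
      exact ⟨hP.root_mem_gapSubsets hV, hP.erase_root hV hroot, by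
        rw [card_erase_of_mem hV, hc, Nat.add_sub_cancel]⟩
    · rintro ⟨V, P⟩ hp
      simp only [mem_sigma, mem_filter, mem_ncPartitions] at hp ⊢
      obtain ⟨hV, hP, hc⟩ := hp
      rw [erase_insert (hP.notMem_of_union (mem_gapSubsets.1 hV).2.1)]
    · rintro ⟨P, V⟩ hp
      simp only [mem_sigma, mem_filter] at hp ⊢
      rw [insert_erase hp.2.1]
    · rintro ⟨V, P⟩ hp
      simp only [mem_sigma, mem_filter, mem_ncPartitions] at hp ⊢
      obtain ⟨hV, hP, hc⟩ := hp
      rw [erase_insert (hP.notMem_of_union (mem_gapSubsets.1 hV).2.1)]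

theorem expKernel_one_eq_sum_ncPartitions (h : Finset ℕ → ℂ) (T : Finset ℕ) :
    expKernel h 1 ∅ T = ∑ P ∈ ncPartitions ∅ T, (hookProd P : ℂ)⁻¹ * ∏ V ∈ P, h V := by
  have hmaps : ∀ P ∈ ncPartitions ∅ T, P.card ∈ range (T.card + 1) := by
    intro P hP
    rw [mem_ncPartitions] at hP
    rw [mem_range, Nat.lt_succ_iff]
    -- One point chosen in each block gives distinct points of `T`, so there are at most `T.card`
    -- blocks and the truncation in `expKernel` loses no partition.
    choose! f hf using hP.nonempty
    refine card_le_card_of_injOn f (fun V hV => ?_) ?_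
    · simpa using hP.subset hV (hf V hV)
    · intro V hV W hW e
      exact hP.eq_of_mem V hV W hW (f V) (hf V hV) (e ▸ hf W hW)
  rw [expKernel, ← sum_fiberwise_of_maps_to hmaps]
  refine sum_congr rfl fun k _ => ?_
  rw [expTerm_eq_sum_ncPartitions h k (empty_subset T), one_pow, mul_one]

/-! ### The hook length formula for forest factorials -/

open Classical in
-- The elements above `v` are `v` itself and those above the covers of `v`. The forest hypothesis
-- makes the up-sets of distinct covers disjoint, so the recursive factorial unrolls into a product
-- of hooks.
theorem treeFactorial_eq_prod_hooks {P : Type} [PartialOrder P] [Fintype P]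
    (hP : ∀ u v w : P, u ≤ w → v ≤ w → u ≤ v ∨ v ≤ u) (v : P) :
    treeFactorial v =
      ∏ w ∈ univ.filter (fun w : P => v ≤ w), (univ.filter (fun x : P => w ≤ x)).card := by
  induction hn : (univ.filter (fun x : P => v ≤ x)).card using Nat.strong_induction_on
    generalizing v with
  | _ n ih =>
    have hsplit : univ.filter (fun w : P => v ≤ w) =
        insert v ((univ.filter fun w : P => v ⋖ w).biUnion fun c => univ.filter (c ≤ ·)) := by
      ext w
      simp only [mem_filter, mem_univ, true_and, mem_insert, mem_biUnion]
      constructor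
      · intro hw
        rcases hw.eq_or_lt with e | hlt
        · exact Or.inl e.symm
        · obtain ⟨c, hc, hcw⟩ := exists_covBy_le_of_lt hlt
          exact Or.inr ⟨c, hc, hcw⟩
      · rintro (rfl | ⟨c, hc, hcw⟩)
        · exact le_rfl
        · exact hc.lt.le.trans hcw
    rw [treeFactorial, hsplit, prod_insert, prod_biUnion, Fintype.card_subtype]
    · congr 1
      rw [← prod_subtype (univ.filter fun w : P => v ⋖ w) (by simp) (fun w => treeFactorial w)]
      refine prod_congr rfl fun c hc => ih _ ?_ c rfl
      rw [mem_filter] at hc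
      rw [← hn]
      refine card_lt_card ((ssubset_iff_of_subset ?_).2 ⟨v, by simp, by simpa using hc.2.lt.not_ge⟩)
      intro x hx
      simp only [mem_filter, mem_univ, true_and] at hx ⊢
      exact hc.2.lt.le.trans hx
    · intro c hc d hd hne
      refine disjoint_left.2 fun x h₁ h₂ => ?_
      simp only [coe_filter, mem_univ, true_and, Set.mem_ofPred_eq, mem_filter] at hc hd h₁ h₂
      rcases hP c d x h₁ h₂ with h | h
      · exact hd.2 hc.lt (lt_of_le_of_ne h hne)
      · exact hc.2 hd.lt (lt_of_le_of_ne h hne.symm)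
    · simp only [mem_biUnion, mem_filter, mem_univ, true_and, not_exists, not_and]
      exact fun c hc => hc.lt.not_ge

open Classical in
theorem forestFactorial_eq_prod_hooks {P : Type} [PartialOrder P] [Fintype P]
    (hP : ∀ u v w : P, u ≤ w → v ≤ w → u ≤ v ∨ v ≤ u) :
    forestFactorial P = ∏ w : P, (univ.filter (fun x : P => w ≤ x)).card := by
  have hsplit : (univ : Finset P) =
      (univ.filter fun v : P => IsMin v).biUnion fun v => univ.filter (v ≤ ·) := by
    ext w
    simp only [mem_univ, mem_biUnion, mem_filter, true_and, true_iff]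
    obtain ⟨v, hvw, hv⟩ := (univ : Finset P).exists_le_minimal (mem_univ w)
    exact ⟨v, fun b hb => hv.2 (mem_univ b) hb, hvw⟩
  rw [forestFactorial, ← prod_subtype (univ.filter fun w : P => IsMin w) (by simp)
    (fun w => treeFactorial w)]
  conv_rhs => rw [hsplit]
  rw [prod_biUnion]
  · refine prod_congr rfl fun v _ => ?_
    -- The earlier rewriting by `hsplit` also changed the `univ` inside the hooks; this restores it.
    rw [treeFactorial_eq_prod_hooks hP v, ← hsplit]
  · intro c hc d hd hne
    refine disjoint_left.2 fun x h₁ h₂ => ?_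
    simp only [coe_filter, mem_univ, true_and, Set.mem_ofPred_eq, mem_filter] at hc hd h₁ h₂
    rcases hP c d x h₁ h₂ with h | h
    · exact hne (h.antisymm (hd h))
    · exact hne.symm (h.antisymm (hc h))

/-! ### Functionals on subwords -/

/-- The value of a family of functionals on the subword of `a` at the positions in `V`. -/
def onSubword {A : Type*} [AddCommGroup A] [Module ℂ A]
    (f : ∀ m : ℕ, MultilinearMap ℂ (fun _ : Fin m => A) ℂ) (a : ℕ → A) (V : Finset ℕ) : ℂ :=
  f V.card fun i => a (V.orderEmbOfFin rfl i)

theorem onSubword_eq {A : Type*} [AddCommGroup A] [Module ℂ A]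
    (f : ∀ m : ℕ, MultilinearMap ℂ (fun _ : Fin m => A) ℂ) (a : ℕ → A) {V : Finset ℕ} {m : ℕ}
    (hm : V.card = m) : onSubword f a V = f m fun i => a (V.orderEmbOfFin hm i) := by
  subst hm
  rfl

theorem onSubword_map {A : Type*} [AddCommGroup A] [Module ℂ A]
    (f : ∀ m : ℕ, MultilinearMap ℂ (fun _ : Fin m => A) ℂ) (a : ℕ → A) {n : ℕ} (e : Fin n ↪o ℕ)
    (V : Finset (Fin n)) : onSubword f a (V.map e.toEmbedding) =
      f V.card fun i => a (e (V.orderEmbOfFin rfl i)) := by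
  rw [onSubword_eq f a (card_map _)]
  congr 1
  funext i
  congr 1
  have := orderEmbOfFin_unique (s := V.map e.toEmbedding) (card_map _)
    (f := fun i => e (V.orderEmbOfFin rfl i)) (fun x => by simp)
    (e.strictMono.comp (V.orderEmbOfFin rfl).strictMono)
  exact (congrFun this i).symm

/-! ### Noncrossing partitions of a chain, seen as families of sets of integers -/

theorem nested_map {n : ℕ} (e : Fin n ↪o ℕ) (V W : Finset (Fin n)) :
    Nested (V.map e.toEmbedding) (W.map e.toEmbedding) ↔ Nested V W := by
  simp [Nested]

theorem hookProd_map {n : ℕ} (e : Fin n ↪o ℕ) (P : Finset (Finset (Fin n))) :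
    hookProd (P.map (mapEmbedding e.toEmbedding).toEmbedding) = hookProd P := by
  classical
  rw [hookProd, prod_map, hookProd]
  refine prod_congr rfl fun V _ => ?_
  rw [filter_map, card_map]
  congr 1
  refine filter_congr fun W _ => ?_
  exact nested_map e V W

namespace NC

variable {n : ℕ}

theorem isNCPartition_map (π : NC n) (e : Fin n ↪o ℕ) :
    IsNCPartition ∅ (univ.map e.toEmbedding)
      (π.1.parts.map (mapEmbedding e.toEmbedding).toEmbedding) where
  nonempty V hV := by
    obtain ⟨V, hV', rfl⟩ := mem_map.1 hV
    exact (π.1.nonempty_of_mem_parts hV').map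
  eq_of_mem V hV W hW x hxV hxW := by
    obtain ⟨V, hV', rfl⟩ := mem_map.1 hV
    obtain ⟨W, hW', rfl⟩ := mem_map.1 hW
    obtain ⟨y, hy, rfl⟩ := mem_map.1 hxV
    rw [π.1.eq_of_mem_parts hV' hW' hy ((mem_map' _).1 hxW)]
  mem_iff x := by
    simp only [sdiff_empty, mem_map, mem_univ, true_and]
    constructor
    · rintro ⟨y, rfl⟩
      obtain ⟨V, ⟨hV, hy⟩, -⟩ := π.1.existsUnique_mem (mem_univ y)
      exact ⟨_, ⟨V, hV, rfl⟩, (mem_map' _).2 hy⟩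
    · rintro ⟨-, ⟨V, hV, rfl⟩, hx⟩
      obtain ⟨y, -, rfl⟩ := mem_map.1 hx
      exact ⟨y, rfl⟩
  noncrossing V hV W hW a ha b hb c hc d hd hab hbc hcd := by
    obtain ⟨V, hV', rfl⟩ := mem_map.1 hV
    obtain ⟨W, hW', rfl⟩ := mem_map.1 hW
    obtain ⟨a, ha', rfl⟩ := mem_map.1 ha
    obtain ⟨b, hb', rfl⟩ := mem_map.1 hb
    obtain ⟨c, hc', rfl⟩ := mem_map.1 hc
    obtain ⟨d, hd', rfl⟩ := mem_map.1 hd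
    rw [π.2 V hV' W hW' a ha' b hb' c hc' d hd' (e.lt_iff_lt.1 hab) (e.lt_iff_lt.1 hbc)
      (e.lt_iff_lt.1 hcd)]
  unseparated V hV u hu := by simp at hu

theorem nestingFactorial_eq_hookProd (π : NC n) : π.nestingFactorial = hookProd π.1.parts := by
  classical
  set e : Fin n ↪o ℕ := Fin.valOrderEmb n
  have hmap : ∀ V : π.Block, V.1.map e.toEmbedding ∈
      π.1.parts.map (mapEmbedding e.toEmbedding).toEmbedding :=
    fun V => (mem_map' _).2 V.2
  have hle : ∀ V W : π.Block, V ≤ W ↔ Nested V.1 W.1 := fun V W => Iff.rfl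
  rw [nestingFactorial, forestFactorial_eq_prod_hooks]
  · rw [hookProd, prod_subtype π.1.parts (fun _ => Iff.rfl)]
    refine prod_congr rfl fun V _ => ?_
    refine card_bij (fun W _ => W.1) ?_ ?_ ?_
    · intro W hW
      exact mem_filter.2 ⟨W.2, (mem_filter.1 hW).2⟩
    · intro W _ X _ h
      exact Subtype.ext h
    · intro W hW
      exact ⟨⟨W, (mem_filter.1 hW).1⟩, mem_filter.2 ⟨mem_univ _, (mem_filter.1 hW).2⟩, rfl⟩
  · intro U V W h₁ h₂
    rw [hle, ← nested_map e] at h₁ h₂ ⊢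
    rw [hle, ← nested_map e V.1]
    exact (π.isNCPartition_map e).nested_or_nested (hmap U) (hmap V) (hmap W) h₁ h₂

/-- Blocks are pulled back along `e`; all of them lie in its range, so mapping forward again
recovers `P`. -/
theorem exists_map_eq (e : Fin n ↪o ℕ) {P : Finset (Finset ℕ)}
    (hP : IsNCPartition ∅ (univ.map e.toEmbedding) P) :
    ∃ π : NC n, π.1.parts.map (mapEmbedding e.toEmbedding).toEmbedding = P := by
  classical
  set f : Finset ℕ → Finset (Fin n) := fun V => univ.filter fun i => e i ∈ V with hf
  have hmem : ∀ V i, i ∈ f V ↔ e i ∈ V := by simp [hf]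
  have hmap : ∀ V ∈ P, (f V).map e.toEmbedding = V := by
    intro V hV
    ext x
    simp only [mem_map, hmem]
    constructor
    · rintro ⟨i, hi, rfl⟩
      exact hi
    · intro hx
      have := hP.subset hV hx
      simp only [sdiff_empty, mem_map, mem_univ, true_and] at this
      obtain ⟨i, rfl⟩ := this
      exact ⟨i, hx, rfl⟩
  refine ⟨⟨Finpartition.ofExistsUnique (P.image f) (fun _ _ => subset_univ _) ?_ ?_, ?_⟩, ?_⟩
  · intro i _
    obtain ⟨V, hV, hi⟩ := (hP.mem_iff (e i)).1 (by simp)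
    refine ⟨f V, ⟨mem_image_of_mem f hV, (hmem V i).2 hi⟩, ?_⟩
    rintro W ⟨hW, hiW⟩
    obtain ⟨W, hW', rfl⟩ := mem_image.1 hW
    rw [hP.eq_of_mem W hW' V hV (e i) ((hmem W i).1 hiW) hi]
  · intro h
    obtain ⟨V, hV, h⟩ := mem_image.1 h
    have := hmap V hV
    rw [h, map_empty] at this
    exact (hP.nonempty V hV).ne_empty this.symm
  · intro V hV W hW a ha b hb c hc d hd hab hbc hcd
    obtain ⟨V, hV', rfl⟩ := mem_image.1 hV
    obtain ⟨W, hW', rfl⟩ := mem_image.1 hW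
    rw [hmem] at ha hb hc hd
    rw [hP.noncrossing V hV' W hW' _ ha _ hb _ hc _ hd (e.lt_iff_lt.2 hab) (e.lt_iff_lt.2 hbc)
      (e.lt_iff_lt.2 hcd)]
  · ext V
    simp only [Finpartition.ofExistsUnique, mem_map, mem_image]
    constructor
    · rintro ⟨-, ⟨W, hW, rfl⟩, rfl⟩
      exact ((hmap W hW).symm ▸ hW : (f W).map e.toEmbedding ∈ P)
    · intro hV
      exact ⟨f V, ⟨V, hV, rfl⟩, hmap V hV⟩

theorem sum_map_eq_sum_ncPartitions (e : Fin n ↪o ℕ) (g : Finset (Finset ℕ) → ℂ) :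
    ∑ π : NC n, g (π.1.parts.map (mapEmbedding e.toEmbedding).toEmbedding) =
      ∑ P ∈ ncPartitions ∅ (univ.map e.toEmbedding), g P := by
  refine sum_bij (fun π _ => π.1.parts.map (mapEmbedding e.toEmbedding).toEmbedding)
    (fun π _ => mem_ncPartitions.2 (π.isNCPartition_map e)) ?_ ?_ (fun _ _ => rfl)
  · intro π _ ρ _ h
    exact Subtype.ext (Finpartition.ext (map_injective _ h))
  · intro P hP
    obtain ⟨π, hπ⟩ := exists_map_eq e (mem_ncPartitions.1 hP)
    exact ⟨π, mem_univ _, hπ⟩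

end NC

/-- The monotone moment-cumulant relation on subwords. -/
theorem IsMonotoneCumulantFamily.expKernel_one {A : Type*} [Ring A] [Algebra ℂ A]
    {φ : A →ₗ[ℂ] ℂ} (hφ : φ 1 = 1) {h : ∀ m : ℕ, MultilinearMap ℂ (fun _ : Fin m => A) ℂ}
    (hh : IsMonotoneCumulantFamily φ h) (a : ℕ → A) (T : Finset ℕ) :
    expKernel (onSubword h a) 1 ∅ T = onSubword (moment φ) a T := by
  -- The moment-cumulant relation starts at length one. On the empty word both sides equal 1, by the
  -- normalization of φ.
  rcases T.eq_empty_or_nonempty with rfl | hT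
  · rw [onSubword_eq _ _ card_empty]
    simp [expKernel, expTerm, moment, MultilinearMap.mkPiAlgebraFin_apply, hφ]
  · have hmap : univ.map (T.orderEmbOfFin rfl).toEmbedding = T := by simp
    rw [onSubword, hh _ hT.card_pos, expKernel_one_eq_sum_ncPartitions]
    conv_lhs => rw [← hmap]
    rw [← NC.sum_map_eq_sum_ncPartitions]
    refine sum_congr rfl fun π _ => ?_
    rw [hookProd_map, NC.nestingFactorial_eq_hookProd, one_div, prod_map]
    congr 1
    refine prod_congr rfl fun V _ => ?_
    exact onSubword_map h a (T.orderEmbOfFin rfl) V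

/-! ### Counting strictly increasing labellings -/

open Classical in
-- Sort the labellings by their image: one with a `k`-element image is a choice of that image
-- together with a strict surjection onto a `k`-chain.
theorem card_strictMono_eq_sum_choose (V : Type*) [Fintype V] [DecidableEq V]
    [PartialOrder V] (N : ℕ) :
    Fintype.card {f : V → Fin N // StrictMono f} = ∑ k ∈ range (Fintype.card V + 1),
      N.choose k * Fintype.card {f : V → Fin k // Function.Surjective f ∧ StrictMono f} := by
  have hfib : ∀ I : Finset (Fin N),
      (univ.filter fun f : V → Fin N => StrictMono f ∧ univ.image f = I).card =
        Fintype.card {f : V → Fin I.card // Function.Surjective f ∧ StrictMono f} := by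
    intro I
    rw [Fintype.card_subtype]
    symm
    refine card_bij (fun g _ v => I.orderEmbOfFin rfl (g v)) ?_ ?_ ?_
    · intro g hg
      simp only [mem_filter, mem_univ, true_and] at hg ⊢
      refine ⟨(I.orderEmbOfFin rfl).strictMono.comp hg.2, ?_⟩
      have : univ.image (fun v => I.orderEmbOfFin rfl (g v)) =
          (univ.image g).image (I.orderEmbOfFin rfl) := (image_image).symm
      rw [this, image_univ_of_surjective hg.1]
      simp
    · intro g _ g' _ e
      funext v
      exact (I.orderEmbOfFin rfl).injective (congrFun e v)
    · intro f hf
      simp only [mem_filter, mem_univ, true_and] at hf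
      obtain ⟨hf, hI⟩ := hf
      have hfI : ∀ v, f v ∈ I := fun v => hI ▸ mem_image_of_mem f (mem_univ v)
      have he : ∀ v, I.orderEmbOfFin rfl ((I.orderIsoOfFin rfl).symm ⟨f v, hfI v⟩) = f v := by
        intro v
        rw [← coe_orderIsoOfFin_apply, OrderIso.apply_symm_apply]
      refine ⟨fun v => (I.orderIsoOfFin rfl).symm ⟨f v, hfI v⟩, ?_, funext he⟩
      simp only [mem_filter, mem_univ, true_and]
      constructor
      · intro j
        have hj : I.orderEmbOfFin rfl j ∈ univ.image f := by
          rw [hI]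
          exact orderEmbOfFin_mem I rfl j
        obtain ⟨v, -, hv⟩ := mem_image.1 hj
        exact ⟨v, (I.orderEmbOfFin rfl).injective ((he v).trans hv)⟩
      · intro v w hvw
        exact (I.orderIsoOfFin rfl).symm.strictMono (hf hvw)
  have hmaps : ∀ f ∈ univ.filter (fun f : V → Fin N => StrictMono f),
      univ.image f ∈ (univ : Finset (Fin N)).powerset := fun f _ => by simp
  rw [Fintype.card_subtype, card_eq_sum_card_fiberwise hmaps]
  simp only [filter_filter, hfib]
  rw [sum_powerset_apply_card
    (fun k => Fintype.card {f : V → Fin k // Function.Surjective f ∧ StrictMono f})]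
  simp only [card_univ, Fintype.card_fin, smul_eq_mul]
  have hbig : ∀ k, Fintype.card V < k →
      Fintype.card {f : V → Fin k // Function.Surjective f ∧ StrictMono f} = 0 := by
    intro k hk
    rw [Fintype.card_eq_zero_iff]
    refine ⟨fun f => ?_⟩
    have := Fintype.card_le_of_surjective f.1 f.2.1
    rw [Fintype.card_fin] at this
    omega
  rcases le_total N (Fintype.card V) with hle | hle
  · refine sum_subset (range_subset_range.2 (by omega)) fun k _ hk => ?_
    rw [mem_range] at hk
    rw [Nat.choose_eq_zero_of_lt (by omega), zero_mul]
  · symm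
    refine sum_subset (range_subset_range.2 (by omega)) fun k _ hk => ?_
    rw [mem_range] at hk
    rw [hbig k (by omega), mul_zero]

-- Strict labellings of planar trees

namespace PlanarTree

open Classical in
/-- The number of strictly increasing labellings of the vertices of `t` by a chain of `N`
elements. -/
noncomputable def strictCount (t : PlanarTree) (N : ℕ) : ℕ :=
  Fintype.card {f : t.Vertex → Fin N // StrictMono f}

theorem strictCount_eq_sum_choose (t : PlanarTree) (N : ℕ) :
    t.strictCount N =
      ∑ k ∈ range (Fintype.card t.Vertex + 1), N.choose k * t.muruaCount k :=
  card_strictMono_eq_sum_choose t.Vertex N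

theorem nil_mem_vertices (t : PlanarTree) : [] ∈ t.vertices := by
  cases t
  simp [vertices]

theorem mem_verticesFrom {ss : List PlanarTree} {i : ℕ} {p : List ℕ} :
    p ∈ verticesFrom i ss ↔
      ∃ (j : Fin ss.length) (q : List ℕ), q ∈ (ss.get j).vertices ∧ p = (i + j.1) :: q := by
  induction ss generalizing i with
  | nil => simp [verticesFrom]
  | cons t ts ih =>
    simp only [verticesFrom, List.mem_append, List.mem_map, ih, List.length_cons, Fin.exists_fin_succ,
      List.get_cons_zero, Fin.val_zero, Fin.val_succ, add_zero]
    refine or_congr ⟨?_, ?_⟩ ⟨?_, ?_⟩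
    · rintro ⟨q, hq, rfl⟩
      exact ⟨q, hq, rfl⟩
    · rintro ⟨q, hq, rfl⟩
      exact ⟨q, hq, rfl⟩
    · rintro ⟨j, q, hq, rfl⟩
      exact ⟨j, q, hq, by rw [add_assoc, add_comm 1]⟩
    · rintro ⟨j, q, hq, rfl⟩
      exact ⟨j, q, hq, by rw [add_assoc, add_comm 1]⟩

/-- The root of a tree. -/
def rootVertex (t : PlanarTree) : t.Vertex := ⟨[], t.nil_mem_vertices⟩

theorem rootVertex_le {t : PlanarTree} (v : t.Vertex) : t.rootVertex ≤ v := List.nil_prefix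

/-- A vertex of the `j`-th subtree grafted to the root. -/
def childVertex {ss : List PlanarTree} (j : Fin ss.length) (v : (ss.get j).Vertex) :
    (node ss).Vertex :=
  ⟨j.1 :: v.1, by
    rw [vertices, List.mem_cons, mem_verticesFrom]
    exact Or.inr ⟨j, v.1, v.2, by rw [zero_add]⟩⟩

theorem vertex_cases {ss : List PlanarTree} (v : (node ss).Vertex) :
    v = rootVertex _ ∨ ∃ j w, v = childVertex (ss := ss) j w := by
  obtain ⟨p, hp⟩ := v
  have hp' := hp
  rw [vertices, List.mem_cons, mem_verticesFrom] at hp'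
  rcases hp' with rfl | ⟨j, q, hq, rfl⟩
  · exact Or.inl rfl
  · exact Or.inr ⟨j, ⟨q, hq⟩, Subtype.ext (by simp [childVertex])⟩

theorem rootVertex_lt_childVertex {ss : List PlanarTree} (j : Fin ss.length)
    (v : (ss.get j).Vertex) : rootVertex (node ss) < childVertex j v :=
  lt_of_le_of_ne (rootVertex_le _) fun h => by
    have := congrArg Subtype.val h
    simp [rootVertex, childVertex] at this

theorem childVertex_le_iff {ss : List PlanarTree} (j : Fin ss.length)
    (v w : (ss.get j).Vertex) : childVertex j v ≤ childVertex j w ↔ v ≤ w := by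
  change j.1 :: v.1 <+: j.1 :: w.1 ↔ v.1 <+: w.1
  simp

theorem childVertex_strictMono {ss : List PlanarTree} (j : Fin ss.length) :
    StrictMono (childVertex (ss := ss) j) := fun v w h =>
  lt_of_le_not_ge ((childVertex_le_iff j v w).2 h.le) fun h' =>
    h.not_ge ((childVertex_le_iff j w v).1 h')

theorem eq_of_childVertex_le {ss : List PlanarTree} {j k : Fin ss.length}
    {v : (ss.get j).Vertex} {w : (ss.get k).Vertex} (h : childVertex j v ≤ childVertex k w) :
    j = k := by
  have h : j.1 :: v.1 <+: k.1 :: w.1 := h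
  rw [List.cons_prefix_cons] at h
  exact Fin.ext h.1

/-- The labelling obtained from labellings of the subtrees by giving the root the label `0`. -/
def graftLabelling {ss : List PlanarTree} {N : ℕ}
    (g : ∀ j : Fin ss.length, (ss.get j).Vertex → Fin N) (v : (node ss).Vertex) : Fin (N + 1) :=
  match v with
  | ⟨[], _⟩ => 0
  | ⟨i :: q, hv⟩ =>
    have h : ∃ h : i < ss.length, q ∈ (ss.get ⟨i, h⟩).vertices := by
      rw [vertices, List.mem_cons, mem_verticesFrom] at hv
      rcases hv with hv | ⟨j, q', hq', e⟩
      · simp at hv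
      · rw [zero_add, List.cons.injEq] at e
        obtain ⟨rfl, rfl⟩ := e
        exact ⟨j.2, hq'⟩
    (g ⟨i, h.1⟩ ⟨q, h.2⟩).succ

theorem graftLabelling_child {ss : List PlanarTree} {N : ℕ}
    (g : ∀ j : Fin ss.length, (ss.get j).Vertex → Fin N) (j : Fin ss.length)
    (v : (ss.get j).Vertex) : graftLabelling g (childVertex j v) = (g j v).succ := rfl

theorem graftLabelling_strictMono {ss : List PlanarTree} {N : ℕ}
    {g : ∀ j : Fin ss.length, (ss.get j).Vertex → Fin N} (hg : ∀ j, StrictMono (g j)) :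
    StrictMono (graftLabelling g) := by
  intro v w hvw
  rcases vertex_cases w with rfl | ⟨k, w, rfl⟩
  · exact absurd (rootVertex_le v) hvw.not_ge
  rcases vertex_cases v with rfl | ⟨j, v, rfl⟩
  · exact Fin.succ_pos _
  · obtain rfl := eq_of_childVertex_le hvw.le
    rw [graftLabelling_child, graftLabelling_child, Fin.succ_lt_succ_iff]
    exact hg j (lt_of_le_not_ge ((childVertex_le_iff _ _ _).1 hvw.le) fun h' =>
      hvw.not_ge ((childVertex_le_iff _ _ _).2 h'))

/-- Only the root can carry the label 0. Either no vertex does, and all labels shift down, or the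
root does, and the subtrees are labelled independently by the `N` other labels. -/
theorem strictCount_node_succ (ss : List PlanarTree) (N : ℕ) :
    (node ss).strictCount (N + 1) =
      (node ss).strictCount N + (ss.map fun s => s.strictCount N).prod := by
  classical
  have hprod : (ss.map fun s => s.strictCount N).prod =
      ∏ j : Fin ss.length, (ss.get j).strictCount N := by
    conv_lhs => rw [← List.ofFn_get ss, List.map_ofFn, List.prod_ofFn]
    rfl
  rw [hprod]
  simp only [strictCount]
  rw [← Fintype.card_pi, ← Fintype.card_sum]
  symm
  refine Fintype.card_congr (Equiv.ofBijective (Sum.elim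
    (fun f => ⟨fun v => (f.1 v).succ, fun v w h => Fin.succ_lt_succ_iff.2 (f.2 h)⟩)
    (fun g => ⟨graftLabelling fun j => (g j).1, graftLabelling_strictMono fun j => (g j).2⟩))
    ⟨?_, ?_⟩)
  · rintro (f | g) (f' | g') h
    · replace h := congrArg Subtype.val h
      congr 1
      exact Subtype.ext (funext fun v => Fin.succ_injective _ (congrFun h v))
    · replace h := congrArg Subtype.val h
      exact absurd (congrFun h (rootVertex _)) (Fin.succ_ne_zero _)
    · replace h := congrArg Subtype.val h
      exact absurd (congrFun h (rootVertex _)).symm (Fin.succ_ne_zero _)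
    · replace h := congrArg Subtype.val h
      congr 1
      funext j
      exact Subtype.ext (funext fun v => Fin.succ_injective _ (congrFun h (childVertex j v)))
  · rintro ⟨f, hf⟩
    have hpos : ∀ j w, f (childVertex (ss := ss) j w) ≠ 0 := fun j w h => by
      have := hf (rootVertex_lt_childVertex j w)
      rw [h] at this
      exact absurd this (Fin.not_lt_zero _)
    by_cases h0 : f (rootVertex _) = 0
    · refine ⟨Sum.inr fun j => ⟨fun w => (f (childVertex j w)).pred (hpos j w),
        fun v w h => Fin.pred_lt_pred_iff.2 (hf (childVertex_strictMono j h))⟩, ?_⟩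
      refine Subtype.ext (funext fun v => ?_)
      rcases vertex_cases v with rfl | ⟨j, w, rfl⟩
      · exact h0.symm
      · simp [graftLabelling_child]
    · have hpos' : ∀ v, f v ≠ 0 := fun v => by
        rcases vertex_cases v with rfl | ⟨j, w, rfl⟩
        · exact h0
        · exact hpos j w
      exact ⟨Sum.inl ⟨fun v => (f v).pred (hpos' v),
        fun v w h => Fin.pred_lt_pred_iff.2 (hf h)⟩, Subtype.ext (funext fun v => by simp)⟩

theorem strictCount_zero (t : PlanarTree) : t.strictCount 0 = 0 := by
  classical
  rw [strictCount, Fintype.card_eq_zero_iff]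
  exact ⟨fun f => (f.1 t.rootVertex).elim0⟩

/-- The number of strictly increasing labellings of the internal vertices of `t` by a chain of `N`
elements. -/
noncomputable def skeletonCount (N : ℕ) (t : PlanarTree) : ℕ :=
  if t.isLeaf then 1 else t.skeleton.strictCount N

/-- Leaves disappear from the skeleton; the convention that `skeletonCount` is 1 on a leaf lets them
stay in the product. -/
theorem prod_map_skeletonList (N : ℕ) (ts : List PlanarTree) :
    ((skeletonList ts).map fun s => s.strictCount N).prod = (ts.map (skeletonCount N)).prod := by
  induction ts with
  | nil => simp [skeletonList]
  | cons t ts ih =>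
    rw [skeletonList, List.map_cons, List.prod_cons, skeletonCount, ← ih]
    split_ifs <;> simp

theorem skeletonCount_node_succ (N : ℕ) (t : PlanarTree) (ts : List PlanarTree) :
    skeletonCount (N + 1) (node (t :: ts)) =
      skeletonCount N (node (t :: ts)) + ((t :: ts).map (skeletonCount N)).prod := by
  rw [← prod_map_skeletonList]
  simp only [skeletonCount, isLeaf, Bool.false_eq_true, if_false, skeleton, strictCount_node_succ]

end PlanarTree

/-! ### Values of trees on words -/

namespace PlanarTree

/-- The positions at which the list `l`, with numbering starting at `i`, takes the value `p`. -/
def positions (p : List ℕ) : List (List ℕ) → ℕ → Finset ℕ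
  | [], _ => ∅
  | q :: l, i => if q = p then insert i (positions p l (i + 1)) else positions p l (i + 1)

theorem mem_positions {p : List ℕ} {l : List (List ℕ)} {i x : ℕ} :
    x ∈ positions p l i ↔ ∃ (m : ℕ) (hm : m < l.length), x = i + m ∧ l[m] = p := by
  induction l generalizing i with
  | nil => simp [positions]
  | cons q l ih =>
    have hsucc : (∃ (m : ℕ) (hm : m < (q :: l).length), x = i + m ∧ (q :: l)[m] = p) ↔
        (x = i ∧ q = p) ∨ x ∈ positions p l (i + 1) := by
      rw [ih]
      constructor
      · rintro ⟨_ | m, hm, hx, e⟩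
        · exact Or.inl ⟨hx, e⟩
        · exact Or.inr ⟨m, by simpa using hm, by omega, by simpa using e⟩
      · rintro (⟨hx, e⟩ | ⟨m, hm, hx, e⟩)
        · exact ⟨0, by simp, hx, e⟩
        · exact ⟨m + 1, by simpa using hm, by omega, by simpa using e⟩
    rw [hsucc, positions]
    split_ifs with h
    · simp [h]
    · simp [h]

theorem positions_of_notMem {p : List ℕ} {l : List (List ℕ)} (h : p ∉ l) (i : ℕ) :
    positions p l i = ∅ := by
  refine eq_empty_of_forall_notMem fun x hx => ?_
  obtain ⟨m, hm, -, rfl⟩ := mem_positions.1 hx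
  exact h (List.getElem_mem hm)

theorem positions_append (p : List ℕ) (l l' : List (List ℕ)) (i : ℕ) :
    positions p (l ++ l') i = positions p l i ∪ positions p l' (i + l.length) := by
  induction l generalizing i with
  | nil => simp [positions]
  | cons q l ih =>
    simp only [List.cons_append, positions, ih, List.length_cons]
    rw [add_assoc, add_comm 1]
    split_ifs
    · rw [insert_union]
    · rfl

theorem positions_map_cons (k : ℕ) (p : List ℕ) (l : List (List ℕ)) (i : ℕ) :
    positions (k :: p) (l.map fun q => k :: q) i = positions p l i := by
  induction l generalizing i with
  | nil => simp [positions]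
  | cons q l ih => simp [positions, ih]

/-- The product, over the corollas of a tree, of a set function evaluated at the set of sectors of
the corolla, when the sectors are numbered from `i` on. -/
def treeValue (F : Finset ℕ → ℂ) (t : PlanarTree) (i : ℕ) : ℂ :=
  ∏ p ∈ t.sectors.toFinset, F (positions p t.sectors i)

/-- The product of the values of consecutive trees, separated by one sector each. -/
def forestValue (F : Finset ℕ → ℂ) : List PlanarTree → ℕ → ℂ
  | [], _ => 1
  | t :: ts, i => treeValue F t i * forestValue F ts (i + t.numLeaves)

/-- The sectors separating consecutive trees of a list. -/
def separators : List PlanarTree → ℕ → Finset ℕ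
  | [], _ => ∅
  | [_], _ => ∅
  | t :: t' :: ts, i =>
    insert (i + t.sectors.length) (separators (t' :: ts) (i + t.numLeaves))

theorem separators_cons {ts : List PlanarTree} (hts : ts ≠ []) (t : PlanarTree) (i : ℕ) :
    separators (t :: ts) i = insert (i + t.sectors.length) (separators ts (i + t.numLeaves)) := by
  cases ts with
  | nil => exact absurd rfl hts
  | cons => rfl

/-- Sectors inside a subtree have nonempty addresses, so the empty address occurs exactly between
consecutive subtrees. -/
theorem positions_nil_sectorsFrom (ts : List PlanarTree) (k i : ℕ) :
    positions [] (sectorsFrom k ts) i = separators ts i := by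
  induction ts generalizing k i with
  | nil => simp [sectorsFrom, positions, separators]
  | cons t ts ih =>
    have h : ∀ j, positions [] (t.sectors.map fun p => k :: p) j = ∅ :=
      positions_of_notMem (by simp)
    cases ts with
    | nil => rw [sectorsFrom, h, separators]
    | cons t' ts =>
      rw [sectorsFrom, positions_append, h, empty_union, positions, if_pos rfl, ih, separators,
        List.length_map, ← length_sectors t, add_assoc]

/-- Apart from the root corolla, the corollas are distributed among the subtrees according to the
first entry of their address; distinct subtrees share no address. -/
theorem prod_sectorsFrom (F : Finset ℕ → ℂ) (ts : List PlanarTree) (k i : ℕ) :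
    ∏ p ∈ (sectorsFrom k ts).toFinset.erase [], F (positions p (sectorsFrom k ts) i) =
      forestValue F ts i := by
  induction ts generalizing k i with
  | nil => simp [sectorsFrom, forestValue]
  | cons t ts ih =>
    have himage : (t.sectors.map fun p => k :: p).toFinset =
        t.sectors.toFinset.image fun p => k :: p := by
      ext p
      simp
    have hnot : [] ∉ t.sectors.toFinset.image fun p => k :: p := by simp
    have hprod : ∀ j, ∏ p ∈ t.sectors.toFinset.image (fun p => k :: p),
        F (positions p (t.sectors.map fun p => k :: p) j) = treeValue F t j := by
      intro j
      rw [prod_image (by simp)]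
      simp only [positions_map_cons]
      rfl
    cases ts with
    | nil =>
      rw [sectorsFrom, himage, erase_eq_of_notMem hnot, hprod]
      simp [forestValue]
    | cons t' ts =>
      have hset : (sectorsFrom k (t :: t' :: ts)).toFinset.erase [] =
          (t.sectors.toFinset.image fun p => k :: p) ∪
            (sectorsFrom (k + 1) (t' :: ts)).toFinset.erase [] := by
        rw [sectorsFrom, List.toFinset_append, himage, List.toFinset_cons, erase_union_distrib,
          erase_eq_of_notMem hnot, erase_insert_eq_erase]
      have hk : ∀ p, k :: p ∉ sectorsFrom (k + 1) (t' :: ts) := fun p hp => by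
        have := sectorsFrom_mem _ _ _ _ hp
        omega
      rw [hset, prod_union, forestValue, ← ih (k + 1), ← hprod i]
      · congr 1
        · refine prod_congr rfl fun p hp => ?_
          obtain ⟨p, -, rfl⟩ := mem_image.1 hp
          rw [sectorsFrom, positions_append, positions, if_neg (by simp),
            positions_of_notMem (hk p), union_empty]
        · refine prod_congr rfl fun p hp => ?_
          rw [mem_erase, List.mem_toFinset] at hp
          have hp' : p ∉ t.sectors.map fun p => k :: p := by
            rw [List.mem_map]
            rintro ⟨q, -, rfl⟩
            exact hk q hp.2
          rw [sectorsFrom, positions_append, positions_of_notMem hp', empty_union, positions,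
            if_neg (Ne.symm hp.1), List.length_map, ← length_sectors t, add_assoc]
      · refine disjoint_left.2 fun p h₁ h₂ => ?_
        obtain ⟨p, -, rfl⟩ := mem_image.1 h₁
        exact hk p (List.mem_toFinset.1 (mem_erase.1 h₂).2)

/-- At least two subtrees are needed for the root to own a sector and so contribute a factor. -/
theorem treeValue_node (F : Finset ℕ → ℂ) (t : PlanarTree) {ts : List PlanarTree} (hts : ts ≠ [])
    (i : ℕ) : treeValue F (node (t :: ts)) i =
      F (separators (t :: ts) i) * forestValue F (t :: ts) i := by
  have hmem : [] ∈ (sectorsFrom 0 (t :: ts)).toFinset := by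
    cases ts with
    | nil => exact absurd rfl hts
    | cons => simp [sectorsFrom]
  rw [treeValue, sectors, ← mul_prod_erase _ _ hmem, positions_nil_sectorsFrom, prod_sectorsFrom]

theorem treeValue_leaf (F : Finset ℕ → ℂ) (i : ℕ) : treeValue F (node []) i = 1 := by
  simp [treeValue, sectors, sectorsFrom]

/-! ### Sums over Schröder trees -/

theorem finite_schroderTrees (m : ℕ) :
    {t : PlanarTree | t.IsSchroder ∧ t.numLeaves = m + 1}.Finite :=
  (finite_isSchroder (m + 1)).subset fun _ h => ⟨h.1, h.2.le⟩

/-- The Schröder trees with `m + 1` leaves. -/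
noncomputable def schroderTrees (m : ℕ) : Finset PlanarTree := (finite_schroderTrees m).toFinset

theorem mem_schroderTrees {m : ℕ} {t : PlanarTree} :
    t ∈ schroderTrees m ↔ t.IsSchroder ∧ t.numLeaves = m + 1 := by
  simp [schroderTrees]

theorem isSchroder_node {ts : List PlanarTree} :
    (node ts).IsSchroder ↔ (ts = [] ∨ 2 ≤ ts.length) ∧ ∀ t ∈ ts, t.IsSchroder :=
  ⟨fun ⟨_, h, hts⟩ => ⟨h, hts⟩, fun h => ⟨ts, h.1, h.2⟩⟩

theorem numLeaves_node_cons (t : PlanarTree) (ts : List PlanarTree) :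
    (node (t :: ts)).numLeaves = t.numLeaves + numLeavesList ts := by
  rw [numLeaves]

theorem finite_schroderForests (m : ℕ) : {ts : List PlanarTree |
    ts ≠ [] ∧ (∀ t ∈ ts, t.IsSchroder) ∧ numLeavesList ts = m + 1}.Finite := by
  -- Grafting a forest together with one extra leaf to a new root gives a Schröder tree with one
  -- more leaf, injectively.
  refine ((finite_schroderTrees (m + 1)).preimage (f := fun ts => node (node [] :: ts)) ?_).subset ?_
  · intro ts _ ts' _ h
    simpa using h
  · rintro ts ⟨hne, hs, hn⟩
    refine ⟨isSchroder_node.2 ⟨Or.inr ?_, ?_⟩, ?_⟩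
    · have := List.length_pos_iff.2 hne
      simp only [List.length_cons]
      omega
    · intro t ht
      rcases List.mem_cons.1 ht with rfl | ht
      · exact isSchroder_node.2 ⟨Or.inl rfl, by simp⟩
      · exact hs t ht
    · rw [numLeaves_node_cons, hn, numLeaves]
      omega

/-- The nonempty lists of Schröder trees with `m + 1` leaves in total. -/
noncomputable def schroderForests (m : ℕ) : Finset (List PlanarTree) :=
  (finite_schroderForests m).toFinset

theorem mem_schroderForests {m : ℕ} {ts : List PlanarTree} :
    ts ∈ schroderForests m ↔
      ts ≠ [] ∧ (∀ t ∈ ts, t.IsSchroder) ∧ numLeavesList ts = m + 1 := by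
  simp [schroderForests]

/-- A forest is one tree, or a first tree with `l + 1` leaves followed by a nonempty forest with the
remaining `m - l = (m - 1 - l) + 1` leaves. -/
theorem sum_schroderForests {M : Type*} [AddCommMonoid M] (m : ℕ) (g : List PlanarTree → M) :
    ∑ ts ∈ schroderForests m, g ts = ∑ t ∈ schroderTrees m, g [t] +
      ∑ l ∈ range m, ∑ t ∈ schroderTrees l, ∑ ts ∈ schroderForests (m - 1 - l), g (t :: ts) := by
  classical
  rw [← sum_filter_add_sum_filter_not _ (fun ts : List PlanarTree => ts.length = 1)]
  congr 1
  · symm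
    refine sum_bij (fun t _ => [t]) ?_ ?_ ?_ (fun _ _ => rfl)
    · intro t ht
      rw [mem_schroderTrees] at ht
      simp [mem_schroderForests, ht, numLeavesList]
    · intro t _ t' _ h
      simpa using h
    · intro ts hts
      rw [mem_filter, mem_schroderForests, List.length_eq_one_iff] at hts
      obtain ⟨⟨-, hs, hn⟩, t, rfl⟩ := hts
      exact ⟨t, mem_schroderTrees.2 ⟨hs t (by simp), by simpa [numLeavesList] using hn⟩, rfl⟩
  · simp only [sum_sigma']
    symm
    refine sum_bij (fun p _ => p.2.1 :: p.2.2) ?_ ?_ ?_ (fun _ _ => rfl)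
    · rintro ⟨l, t, ts⟩ h
      simp only [mem_sigma, mem_range, mem_schroderTrees, mem_schroderForests] at h
      obtain ⟨hl, ⟨ht, htn⟩, hne, hs, hn⟩ := h
      rw [mem_filter, mem_schroderForests]
      refine ⟨⟨by simp, ?_, ?_⟩, ?_⟩
      · intro s hs'
        rcases List.mem_cons.1 hs' with rfl | hs'
        · exact ht
        · exact hs s hs'
      · rw [numLeavesList, htn, hn]
        omega
      · have := List.length_pos_iff.2 hne
        simp only [List.length_cons]
        omega
    · rintro ⟨l, t, ts⟩ h ⟨l', t', ts'⟩ h' e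
      simp only [mem_sigma, mem_schroderTrees] at h h'
      simp only [List.cons.injEq] at e
      obtain ⟨rfl, rfl⟩ := e
      obtain rfl : l = l' := by
        have := h.2.1.2
        have := h'.2.1.2
        omega
      rfl
    · intro ts hts
      rw [mem_filter, mem_schroderForests] at hts
      obtain ⟨⟨hne, hs, hn⟩, hlen⟩ := hts
      rcases ts with _ | ⟨t, _ | ⟨t', ts⟩⟩
      · exact absurd rfl hne
      · exact absurd rfl hlen
      · have h₁ := numLeaves_pos t
        have h₂ := numLeaves_pos t'
        have h₃ : numLeaves t + numLeavesList (t' :: ts) = m + 1 := hn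
        have h₄ : numLeavesList (t' :: ts) = numLeaves t' + numLeavesList ts := rfl
        refine ⟨⟨t.numLeaves - 1, t, t' :: ts⟩, ?_, rfl⟩
        simp only [mem_sigma, mem_range, mem_schroderTrees, mem_schroderForests]
        exact ⟨by omega, ⟨hs t (by simp), by omega⟩, by simp,
          fun s hs' => hs s (List.mem_cons_of_mem _ hs'), by omega⟩

theorem schroderTrees_zero : schroderTrees 0 = {node []} := by
  ext t
  rw [mem_schroderTrees, mem_singleton]
  constructor
  · rcases t with ⟨_ | ⟨t, ts⟩⟩
    · simp
    · rintro ⟨h, hn⟩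
      have h₁ := numLeaves_pos t
      have h₂ := numLeavesList_ge_length ts
      have h₃ := (isSchroder_node.1 h).1
      rw [numLeaves_node_cons] at hn
      simp only [reduceCtorEq, List.length_cons, false_or] at h₃
      omega
  · rintro rfl
    exact ⟨isSchroder_node.2 ⟨Or.inl rfl, by simp⟩, by rw [numLeaves]⟩

theorem sum_schroderTrees {M : Type*} [AddCommMonoid M] {m : ℕ} (hm : m ≠ 0)
    (g : PlanarTree → M) :
    ∑ t ∈ schroderTrees m, g t =
      ∑ l ∈ range m, ∑ t ∈ schroderTrees l, ∑ ts ∈ schroderForests (m - 1 - l),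
        g (node (t :: ts)) := by
  simp only [sum_sigma']
  symm
  refine sum_bij (fun p _ => node (p.2.1 :: p.2.2)) ?_ ?_ ?_ (fun _ _ => rfl)
  · rintro ⟨l, t, ts⟩ h
    simp only [mem_sigma, mem_range, mem_schroderTrees, mem_schroderForests] at h
    obtain ⟨hl, ⟨ht, htn⟩, hne, hs, hn⟩ := h
    rw [mem_schroderTrees, isSchroder_node, numLeaves_node_cons]
    have := List.length_pos_iff.2 hne
    refine ⟨⟨Or.inr (by simp only [List.length_cons]; omega), ?_⟩, ?_⟩
    swap
    · change t.numLeaves + numLeavesList ts = m + 1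
      omega
    intro s hs'
    rcases List.mem_cons.1 hs' with rfl | hs'
    · exact ht
    · exact hs s hs'
  · rintro ⟨l, t, ts⟩ h ⟨l', t', ts'⟩ h' e
    simp only [mem_sigma, mem_schroderTrees] at h h'
    simp only [node.injEq, List.cons.injEq] at e
    obtain ⟨rfl, rfl⟩ := e
    obtain rfl : l = l' := by
      have := h.2.1.2
      have := h'.2.1.2
      omega
    rfl
  · intro t ht
    rw [mem_schroderTrees] at ht
    obtain ⟨hs, hn⟩ := ht
    rcases t with ⟨_ | ⟨t, _ | ⟨t', ts⟩⟩⟩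
    · rw [numLeaves] at hn
      omega
    · simpa using (isSchroder_node.1 hs).1
    · rw [isSchroder_node] at hs
      have h₁ := numLeaves_pos t
      have h₂ := numLeaves_pos t'
      rw [numLeaves_node_cons] at hn
      have h₄ : numLeavesList (t' :: ts) = numLeaves t' + numLeavesList ts := rfl
      refine ⟨⟨t.numLeaves - 1, t, t' :: ts⟩, ?_, rfl⟩
      simp only [mem_sigma, mem_range, mem_schroderTrees, mem_schroderForests]
      exact ⟨by omega, ⟨hs.2 t (by simp), by omega⟩, by simp,
        fun s hs' => hs.2 s (List.mem_cons_of_mem _ hs'), by omega⟩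

end PlanarTree

/-! ### Comparison of the exponential with sums over Schröder trees -/

theorem sum_powerset_Ico_eq_sum_min {M : Type*} [AddCommMonoid M] (i m : ℕ)
    (f : Finset ℕ → M) :
    ∑ S ∈ (Ico i (i + m)).powerset, f S = f ∅ +
      ∑ l ∈ range m, ∑ S ∈ (Ico (i + l + 1) (i + m)).powerset, f (insert (i + l) S) := by
  induction m generalizing i with
  | zero => simp
  | succ m ih =>
    have hins : Ico i (i + (m + 1)) = insert i (Ico (i + 1) (i + 1 + m)) := by
      ext x
      simp only [mem_Ico, mem_insert]
      omega
    rw [hins, sum_powerset_insert (by simp), ih (i + 1), sum_range_succ', add_assoc]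
    have e : ∀ l, i + (l + 1) = i + 1 + l := fun l => by omega
    exact congrArg₂ (· + ·) rfl (congrArg₂ (· + ·) (sum_congr rfl fun l _ => by rw [e l, e m])
      (by rw [add_zero, e m]))

/-- Cut at the minimum `i + l` of the set: nothing of it remains on the left, so the first gap
becomes an entry starting from the empty set. -/
theorem expKernel_insert (h : Finset ℕ → ℂ) (x : ℂ) {i l m : ℕ} (hl : l < m) {S : Finset ℕ}
    (hS : S ⊆ Ico (i + l + 1) (i + m)) :
    expKernel h x (insert (i + l) S) (Ico i (i + m)) =
      expKernel h x ∅ (Ico i (i + l)) * expKernel h x S (Ico (i + l + 1) (i + m)) := by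
  rw [expKernel_cut h x (mem_insert_self (i + l) S) (by simp [hl])]
  have hS' : ∀ y ∈ S, i + l < y := fun y hy => by
    have := mem_Ico.1 (hS hy)
    omega
  congr 2
  · rw [filter_insert, if_neg (lt_irrefl _), filter_false_of_mem fun y hy => (hS' y hy).asymm]
  · ext y
    simp only [mem_filter, mem_Ico]
    omega
  · rw [filter_insert, if_neg (lt_irrefl _), filter_true_of_mem hS']
  · ext y
    simp only [mem_filter, mem_Ico]
    omega

namespace PlanarTree

variable (h F : Finset ℕ → ℂ)

/-- The sum over the Schröder trees with `m + 1` leaves of the number of labellings by `N` labels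
times the value on the word that starts at position `i`. -/
noncomputable def treeSum (N i m : ℕ) : ℂ :=
  ∑ t ∈ schroderTrees m, (skeletonCount N t : ℂ) * treeValue F t i

variable {F}

/-- A list of at least two trees is a nonempty separator set with a tree in each gap, and by `hN`
the trees in a gap sum to an entry of the kernel. The weight `α` is arbitrary so that the induction
can absorb the first separator into it. -/
theorem sum_forests_eq_sum_powerset {N : ℕ}
    (hN : ∀ i m, treeSum F N i m = expKernel h N ∅ (Ico i (i + m)))
    (α : Finset ℕ → ℂ) (i m : ℕ) :
    ∑ l ∈ range m, ∑ t ∈ schroderTrees l, ∑ ts ∈ schroderForests (m - 1 - l),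
        α (separators (t :: ts) i) *
          ((((t :: ts).map (skeletonCount N)).prod : ℕ) * forestValue F (t :: ts) i) =
      ∑ l ∈ range m, ∑ S ∈ (Ico (i + l + 1) (i + m)).powerset,
        α (insert (i + l) S) * expKernel h N (insert (i + l) S) (Ico i (i + m)) := by
  induction m using Nat.strong_induction_on generalizing i α with
  | _ m ih =>
    refine sum_congr rfl fun l hl => ?_
    rw [mem_range] at hl
    obtain ⟨k, rfl⟩ : ∃ k, m = l + 1 + k := ⟨m - 1 - l, by omega⟩
    have hk : l + 1 + k - 1 - l = k := by omega
    have hi : i + (l + 1 + k) = i + l + 1 + k := by omega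
    have hforest : ∑ ts ∈ schroderForests k, α (insert (i + l) (separators ts (i + l + 1))) *
        (((ts.map (skeletonCount N)).prod : ℕ) * forestValue F ts (i + l + 1)) =
        ∑ S ∈ (Ico (i + l + 1) (i + l + 1 + k)).powerset,
          α (insert (i + l) S) * expKernel h N S (Ico (i + l + 1) (i + l + 1 + k)) := by
      -- In what follows the first separator, a single tree corresponds to `S = ∅` and several trees
      -- to nonempty `S`.
      rw [sum_schroderForests, ih k (by omega) (fun S => α (insert (i + l) S)),
        sum_powerset_Ico_eq_sum_min]
      congr 1
      rw [← hN, treeSum, mul_sum]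
      refine sum_congr rfl fun t _ => ?_
      simp [separators, forestValue]
    rw [hk]
    calc _ = ∑ t ∈ schroderTrees l, ((skeletonCount N t : ℂ) * treeValue F t i) *
          ∑ ts ∈ schroderForests k, α (insert (i + l) (separators ts (i + l + 1))) *
            (((ts.map (skeletonCount N)).prod : ℕ) * forestValue F ts (i + l + 1)) := by
          refine sum_congr rfl fun t ht => ?_
          rw [mul_sum]
          refine sum_congr rfl fun ts hts => ?_
          have hn := (mem_schroderTrees.1 ht).2
          have hlen : t.sectors.length = l := by
            have := length_sectors t
            omega
          rw [separators_cons (mem_schroderForests.1 hts).1, hlen, forestValue, hn, ← add_assoc i,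
            List.map_cons, List.prod_cons, Nat.cast_mul]
          ring
      _ = _ := by
          rw [← sum_mul, hforest]
          change treeSum F N i l * _ = _
          rw [hN, mul_sum]
          refine sum_congr (by rw [hi]) fun S hS => ?_
          rw [expKernel_insert h N hl (mem_powerset.1 hS), hi]
          ring

/-- The powers of the exponential kernel, expanded over Schröder trees. -/
theorem treeSum_eq_expKernel (hF : ∀ T, expKernel h 1 ∅ T = F T) (N i m : ℕ) :
    treeSum F N i m = expKernel h N ∅ (Ico i (i + m)) := by
  have hzero : ∀ N i, treeSum F N i 0 = expKernel h N ∅ (Ico i (i + 0)) := by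
    intro N i
    simp [treeSum, schroderTrees_zero, treeValue_leaf, skeletonCount, isLeaf, expKernel, expTerm]
  induction N generalizing i m with
  | zero =>
    rcases Nat.eq_zero_or_pos m with rfl | hm
    · exact hzero 0 i
    · rw [Nat.cast_zero, expKernel_zero, if_neg, treeSum, sum_schroderTrees hm.ne']
      · refine sum_eq_zero fun l _ => sum_eq_zero fun t _ => sum_eq_zero fun ts _ => ?_
        rw [skeletonCount, isLeaf, if_neg (by simp), strictCount_zero, Nat.cast_zero, zero_mul]
      · intro e
        have : i ∈ Ico i (i + m) := by simp [hm]
        simp [← e] at this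
  | succ N ih =>
    rcases Nat.eq_zero_or_pos m with rfl | hm
    · exact hzero (N + 1) i
    · have hF' : ∀ T S, expKernel h 1 ∅ S * expKernel h N S T = F S * expKernel h N S T :=
        fun T S => by rw [hF]
      have hF0 : F ∅ = 1 := by
        rw [← hF]
        simp [expKernel, expTerm]
      -- The unit step is taken first, so its set `S` is the outermost block. The term `S = ∅` is
      -- the sum for `N` labels; nonempty `S` give the trees whose root has label 0.
      rw [Nat.cast_succ, add_comm (N : ℂ), expKernel_add, sum_congr rfl fun S _ => hF' _ S,
        sum_powerset_Ico_eq_sum_min, ← sum_forests_eq_sum_powerset h ih, ← ih, treeSum, treeSum,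
        hF0, one_mul, sum_schroderTrees hm.ne', sum_schroderTrees hm.ne', ← sum_add_distrib]
      refine sum_congr rfl fun l _ => ?_
      rw [← sum_add_distrib]
      refine sum_congr rfl fun t _ => ?_
      rw [← sum_add_distrib]
      refine sum_congr rfl fun ts hts => ?_
      rw [skeletonCount_node_succ, treeValue_node F t (mem_schroderForests.1 hts).1, Nat.cast_add]
      ring

end PlanarTree

/-! ### Extraction of the linear coefficient -/

open Polynomial in
-- X(X-1)⋯(X-k) has as linear coefficient the value at 0 of (X-1)⋯(X-k), which is the falling
-- factorial of length `k` at -1.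
theorem coeff_one_descPochhammer_succ (k : ℕ) :
    (descPochhammer ℂ (k + 1)).coeff 1 = (-1) ^ k * (k.factorial : ℂ) := by
  have hd : ∀ k : ℕ, (descPochhammer ℂ k).eval (-1) = (-1) ^ k * (k.factorial : ℂ) := by
    intro k
    induction k with
    | zero => simp
    | succ k ih =>
      rw [descPochhammer_succ_eval, ih, Nat.factorial_succ]
      push_cast
      ring
  rw [descPochhammer_succ_left, coeff_X_mul, coeff_zero_eq_eval_zero, eval_comp]
  simp [hd]

open Polynomial in
/-- The polynomial whose value at `N` is the number of strictly increasing labellings of `t` by `N`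
labels. -/
noncomputable def PlanarTree.strictPoly (t : PlanarTree) : ℂ[X] :=
  ∑ k ∈ range (Fintype.card t.Vertex + 1),
    C ((t.muruaCount k : ℂ) * (k.factorial : ℂ)⁻¹) * descPochhammer ℂ k

open Polynomial in
theorem PlanarTree.eval_strictPoly (t : PlanarTree) (N : ℕ) :
    t.strictPoly.eval (N : ℂ) = t.strictCount N := by
  rw [strictPoly, eval_finsetSum, strictCount_eq_sum_choose, Nat.cast_sum]
  refine sum_congr rfl fun k _ => ?_
  rw [eval_mul, eval_C, descPochhammer_eval_eq_descFactorial,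
    Nat.descFactorial_eq_factorial_mul_choose, Nat.cast_mul, Nat.cast_mul]
  field_simp [Nat.cast_ne_zero.2 k.factorial_ne_zero]

open Polynomial in
-- The constant term `k = 0` contributes nothing, and for `k ≥ 1` the linear coefficient
-- (-1)^{k-1}(k-1)! divided by k! is (-1)^{k+1}/k.
theorem PlanarTree.coeff_one_strictPoly (t : PlanarTree) :
    t.strictPoly.coeff 1 = ((t.murua : ℚ) : ℂ) := by
  have hIcc : Icc 1 (Fintype.card t.Vertex) = (range (Fintype.card t.Vertex)).map
      ⟨Nat.succ, Nat.succ_injective⟩ := by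
    ext k
    simp only [mem_Icc, mem_map, mem_range, Function.Embedding.coeFn_mk, Nat.succ_eq_add_one]
    exact ⟨fun hk => ⟨k - 1, by omega, by omega⟩, fun ⟨j, hj, e⟩ => by omega⟩
  rw [strictPoly, finsetSum_coeff, sum_range_succ', murua, Rat.cast_sum, hIcc, sum_map]
  simp only [coeff_C_mul, coeff_one_descPochhammer_succ, descPochhammer_zero, coeff_one,
    one_ne_zero, if_false, mul_zero, add_zero, Function.Embedding.coeFn_mk]
  refine sum_congr rfl fun k _ => ?_
  have hk : (k.factorial : ℂ) ≠ 0 := Nat.cast_ne_zero.2 k.factorial_ne_zero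
  have hk' : (k : ℂ) + 1 ≠ 0 := Nat.cast_add_one_ne_zero k
  rw [Nat.factorial_succ, Nat.succ_eq_add_one]
  push_cast
  field_simp
  ring

-- The blocks of π(t) as corollas of t

namespace SchroderTree

variable {n : ℕ}

theorem partitionFunctional_partition {A : Type*} [AddCommGroup A] [Module ℂ A]
    (f : ∀ m : ℕ, MultilinearMap ℂ (fun _ : Fin m => A) ℂ) (t : SchroderTree n) (a : ℕ → A) :
    partitionFunctional f t.partition (fun i : Fin n => a i) =
      treeValue (onSubword f a) t.1 0 := by
  classical
  have hlen : t.1.sectors.length = n := by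
    have := length_sectors t.1
    have := t.2.2
    omega
  have hpart : ∀ i : Fin n, ((t.partition.1.part i).map (Fin.valOrderEmb n).toEmbedding) =
      positions (t.sectorVertex i) t.1.sectors 0 := by
    intro i
    ext x
    rw [mem_positions]
    simp only [mem_map, zero_add]
    constructor
    · rintro ⟨j, hj, rfl⟩
      rw [partition, Finpartition.mem_part_ofSetoid_iff_rel] at hj
      exact ⟨j.1, by omega, rfl, Eq.symm hj⟩
    · rintro ⟨m, hm, rfl, e⟩
      refine ⟨⟨x, by omega⟩, ?_, rfl⟩
      rw [partition, Finpartition.mem_part_ofSetoid_iff_rel]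
      exact e.symm
  change ∏ V ∈ t.partition.1.parts, _ = _
  symm
  have hv : ∀ p ∈ t.1.sectors.toFinset, ∃ i : Fin n, t.sectorVertex i = p := by
    intro p hp
    obtain ⟨m, hm, e⟩ := List.getElem_of_mem (List.mem_toFinset.1 hp)
    exact ⟨⟨m, by omega⟩, e⟩
  choose g hg using hv
  -- An address occurring among the sectors corresponds to the block of any sector carrying it; `g`
  -- picks one.
  refine prod_bij (fun p hp => t.partition.1.part (g p hp)) ?_ ?_ ?_ ?_
  · intro p _
    exact t.partition.1.part_mem.2 (mem_univ _)
  · intro p hp q hq e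
    have h : g q hq ∈ t.partition.1.part (g p hp) := by
      rw [e]
      exact t.partition.1.mem_part (mem_univ _)
    rw [partition, Finpartition.mem_part_ofSetoid_iff_rel] at h
    rw [← hg p hp, ← hg q hq]
    exact h
  · intro V hV
    obtain ⟨i, hi⟩ := t.partition.1.nonempty_of_mem_parts hV
    have hp : t.sectorVertex i ∈ t.1.sectors.toFinset :=
      List.mem_toFinset.2 (List.getElem_mem _)
    refine ⟨t.sectorVertex i, hp, ?_⟩
    refine t.partition.1.part_eq_of_mem hV ?_
    have h : g (t.sectorVertex i) hp ∈ t.partition.1.part i := by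
      rw [partition, Finpartition.mem_part_ofSetoid_iff_rel]
      exact (hg _ hp).symm
    rwa [t.partition.1.part_eq_of_mem hV hi] at h
  · intro p hp
    conv_lhs => rw [← hg p hp, ← hpart]
    rw [onSubword_map]
    rfl

end SchroderTree

-- Comparison of linear coefficients

theorem theorem1p1 {A : Type*} [Ring A] [Algebra ℂ A] (φ : A →ₗ[ℂ] ℂ) (hφ : φ 1 = 1)
    (n : ℕ) (hn : 1 ≤ n) (a : Fin n → A) :
    monotoneCumulant φ n a =
      ∑ t : SchroderTree n, ((t.1.skeleton.murua : ℚ) : ℂ) *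
        partitionFunctional (moment φ) t.partition a := by
  -- The word is padded with zeros to be indexed by ℕ; only the positions below `n` are used.
  obtain ⟨b, rfl⟩ : ∃ b : ℕ → A, a = fun i : Fin n => b i :=
    ⟨fun i => if hi : i < n then a ⟨i, hi⟩ else 0, by simp⟩
  set h := onSubword (monotoneCumulant φ) b with hh
  set F := onSubword (moment φ) b with hF
  set p : Polynomial ℂ := ∑ k ∈ range (n + 1), Polynomial.C (expTerm h k ∅ (Ico 0 n)) *
    Polynomial.X ^ k with hp
  set q : Polynomial ℂ := ∑ t ∈ schroderTrees n, Polynomial.C (treeValue F t 0) *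
    t.skeleton.strictPoly with hq
  -- Both polynomials take the value of exp(ND)(∅, {0,…,n-1}) at every natural number N, so they
  -- coincide.
  have hpq : p = q := by
    refine Polynomial.eq_of_infinite_eval_eq p q (Set.infinite_of_injective_forall_mem
      (f := fun N : ℕ => (N : ℂ)) Nat.cast_injective fun N => ?_)
    have key := treeSum_eq_expKernel h
      ((isMonotoneCumulantFamily_monotoneCumulant φ).expKernel_one hφ b) N 0 n
    rw [zero_add] at key
    simp only [Set.mem_ofPred_eq]
    rw [hp, hq, Polynomial.eval_finsetSum, Polynomial.eval_finsetSum]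
    simp only [Polynomial.eval_mul, Polynomial.eval_C, Polynomial.eval_pow, Polynomial.eval_X,
      eval_strictPoly]
    rw [expKernel_eq_sum_range h (B := n + 1) (by simp), treeSum] at key
    rw [← key]
    refine sum_congr rfl fun t ht => ?_
    rw [skeletonCount, if_neg, mul_comm]
    rw [mem_schroderTrees] at ht
    rcases t with ⟨_ | ⟨t, ts⟩⟩
    · rw [numLeaves] at ht
      omega
    · simp [isLeaf]
  have hcoeff := congrArg (fun r => Polynomial.coeff r 1) hpq
  simp only [hp, hq, Polynomial.finsetSum_coeff, Polynomial.coeff_C_mul, Polynomial.coeff_X_pow,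
    coeff_one_strictPoly, mul_ite, mul_one, mul_zero, sum_ite_eq, mem_range] at hcoeff
  rw [if_pos (by omega), expTerm_one h ⟨0, by simp; omega⟩] at hcoeff
  -- Going through the one-block partition avoids transporting the arity along the equality of `(Ico
  -- 0 n).card` with `n`.
  have hhn : h (Ico 0 n) = monotoneCumulant φ n fun i : Fin n => b i := by
    have hmap : (univ : Finset (Fin n)).map (Fin.valOrderEmb n).toEmbedding = Ico 0 n := by
      ext x
      simp only [mem_map, mem_univ, true_and, mem_Ico, zero_le]
      exact ⟨fun ⟨y, hy⟩ => hy ▸ y.2, fun hx => ⟨⟨x, hx⟩, rfl⟩⟩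
    obtain ⟨π, hπ⟩ := NC.exists_parts_eq hn
    rw [← partitionFunctional_of_parts_eq (monotoneCumulant φ) π hπ, ← hmap, hh, onSubword_map]
    change _ = ∏ V ∈ π.1.parts, _
    rw [hπ, prod_singleton]
    rfl
  rw [← hhn, hcoeff]
  refine sum_bij' (fun t ht => (⟨t, mem_schroderTrees.1 ht⟩ : SchroderTree n)) (fun t _ => t.1)
    (fun _ _ => mem_univ _) (fun t _ => mem_schroderTrees.2 t.2) (fun _ _ => rfl) (fun _ _ => rfl)
    fun t ht => ?_
  exact (mul_comm _ _).trans (congrArg (((t.skeleton.murua : ℚ) : ℂ) * ·)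
    (SchroderTree.partitionFunctional_partition (moment φ)
      (⟨t, mem_schroderTrees.1 ht⟩ : SchroderTree n) b).symm)
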